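/- **Setting.** Let $\mathbf X=(X(t),\,t\in\mathbb R)$ be a real-valued stationary process (its finite-dimensional distributions are invariant under time shifts) on a probability space $(\Omega,\mathcal F,P)$, all of whose sample paths are upper semicontinuous. Assume that $\mathbf X$ is separable in the sense of Doob: there is a countable $D\subset\mathbb R$ such that, with probability 1, every point $(t,X(t))$, $t\in\mathbb R$, of the graph of the path lies in the closure of $\{(s,X(s)):s\in D\}$ (this is automatic if the sample paths are continuous). For $T>0$ let $$\tau_{\mathbf X,T}=\min\Bigl\{t\in[0,T]:\ X(t)=\sup_{0\le s\le T}X(s)\Bigr\}$$ be the leftmost location of the supremum over $[0,T]$. **Assumption TailSM.** There is a function $\varphi:(0,\infty)\to\mathbb R$ such that $$\lim_{t\to\infty}P\Bigl(\sup_{0\le s\le t}X(s)\ge\varphi(t)\Bigr)=1$$ and, as $t\to\infty$, $$\sup\Bigl\{\bigl|P(A\cap B)-P(A)P(B)\bigr|:\ A\in\sigma\bigl(X(s)\mathbf 1(X(s)\ge\varphi(t)),\,s\le 0\bigr),\ B\in\sigma\bigl(X(s)\mathbf 1(X(s)\ge\varphi(t)),\,s\ge t\bigr)\Bigr\}\to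 0 .$$ **Assumption A.** $$\lim_{T\to\infty}\ \sup_{x\in\mathbb R}P\Bigl(\sup_{t\in[0,T]}X(t)=x\Bigr)=0 .$$ **Corollary.** Suppose that $\mathbf X$ satisfies Assumption TailSM and Assumption A. Let $a_T,a_T',b_T',b_T$ be real numbers such that, for all sufficiently large $T$, $0<a_T\le a_T'<b_T'\le b_T<T$, and suppose that $$\liminf_{T\to\infty}\frac{a_T}{T}>0,\qquad \limsup_{T\to\infty}\frac{b_T}{T}<1,\qquad \lim_{T\to\infty}\frac{b_T'-a_T'}{b_T-a_T}=\theta .$$ Then $P\bigl(\tau_{\mathbf X,T}\in(a_T,b_T)\bigr)>0$ for all sufficiently large $T$, and $$\lim_{T\to\infty}P\Bigl(\tau_{\mathbf X,T}\in(a_T',b_T')\Bigm|\tau_{\mathbf X,T}\in(a_T,b_T)\Bigr)=\theta .$$ -/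

import Mathlib

open Set Filter Topology MeasureTheory ProbabilityTheory

namespace SupLocation

/-- `sup_{a ≤ s ≤ b} x(s)`. For an upper semicontinuous path `x` and `a ≤ b` this supremum is
finite and attained. -/
noncomputable def pathSup (x : ℝ → ℝ) (a b : ℝ) : ℝ :=
  sSup (x '' Icc a b)

/-- The leftmost location of the supremum of the path `x` over `[a, b]`. For an upper
semicontinuous `x` and `a ≤ b` the set below is nonempty and compact, so that the infimum is
a minimum. -/
noncomputable def leftmostSupLoc (x : ℝ → ℝ) (a b : ℝ) : ℝ :=
  sInf {t ∈ Icc a b | x t = pathSup x a b}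

variable {Ω : Type*} [MeasurableSpace Ω]

/-- Strict stationarity: the law of the process `(X(t))_{t ∈ ℝ}` on `ℝ^ℝ` with the product
σ-algebra (that is, the family of its finite-dimensional distributions) is invariant under
all time shifts. -/
def IsStationary (X : ℝ → Ω → ℝ) (P : Measure Ω) : Prop :=
  ∀ h : ℝ, IdentDistrib (fun ω (t : ℝ) => X (t + h) ω) (fun ω (t : ℝ) => X t ω) P P

/-- Separability in the sense of Doob: there is a countable set `D` of times such that, almost
surely, every point `(t, X(t))` of the graph of the path is a limit of points
`(s, X(s))` with `s ∈ D`. -/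
def IsSeparableProcess (X : ℝ → Ω → ℝ) (P : Measure Ω) : Prop :=
  ∃ D : Set ℝ, D.Countable ∧
    ∀ᵐ ω ∂P, ∀ t : ℝ, (t, X t ω) ∈ closure ((fun s : ℝ => (s, X s ω)) '' D)

/-- The σ-algebra `σ(X(s) 1(X(s) ≥ c), s ∈ S)`. -/
noncomputable abbrev tailSigma (X : ℝ → Ω → ℝ) (c : ℝ) (S : Set ℝ) : MeasurableSpace Ω :=
  ⨆ s ∈ S, MeasurableSpace.comap ({ω | c ≤ X s ω}.indicator (X s)) (borel ℝ)

/-- The strong mixing coefficient `sup |P(A ∩ B) - P(A) P(B)|` over `A ∈ 𝒜`, `B ∈ ℬ`. -/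
noncomputable def mixingCoeff (P : Measure Ω) (𝒜 ℬ : MeasurableSpace Ω) : ℝ :=
  sSup {r : ℝ | ∃ A B : Set Ω, MeasurableSet[𝒜] A ∧ MeasurableSet[ℬ] B ∧
    r = |P.real (A ∩ B) - P.real A * P.real B|}

/-- Assumption TailSM. Only the values of `φ` at large `t` matter. -/
def TailSM (X : ℝ → Ω → ℝ) (P : Measure Ω) : Prop :=
  ∃ φ : ℝ → ℝ,
    Tendsto (fun t : ℝ => P.real {ω | φ t ≤ pathSup (fun s => X s ω) 0 t}) atTop (𝓝 1) ∧
    Tendsto (fun t : ℝ =>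
      mixingCoeff P (tailSigma X (φ t) (Iic 0)) (tailSigma X (φ t) (Ici t))) atTop (𝓝 0)

/-- Assumption A: the largest atom of the supremum over `[0, T]` vanishes as `T → ∞`. -/
def AssumptionA (X : ℝ → Ω → ℝ) (P : Measure Ω) : Prop :=
  Tendsto (fun T : ℝ => ⨆ x : ℝ, P.real {ω | pathSup (fun s => X s ω) 0 T = x}) atTop (𝓝 0)

/-- The event that the leftmost supremum location over `[0, T]` lies in `(u, v)`. -/
def locEvent (X : ℝ → Ω → ℝ) (T u v : ℝ) : Set Ω :=
  {ω | leftmostSupLoc (fun s => X s ω) 0 T ∈ Ioo u v}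

end SupLocation

namespace SupLocation

/-! ### Deterministic facts on suprema of upper semicontinuous paths -/

section Path

variable {x : ℝ → ℝ} {a b u v : ℝ}

/-! On every scale the location of the supremum becomes uniform away from the ends of the window,
and the conditional probability is then a ratio of lengths. The proof has a probabilistic half at
macroscopic scale and a geometric half that descends to all smaller scales.

Macroscopic half. Take `n` blocks of length `m s` separated by gaps of length `s`. By TailSM the
events that the block maxima exceed levels above `φ s` are nearly independent, and by stationarity
the maxima share one law. Assumption A makes this law nearly continuous, so it has quantiles `y i`
of level about `i / R`. If block `j` carries the largest maximum and its maximum lies between two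
consecutive quantiles, every other maximum lies below the upper one. Summing over the quantiles
gives a Riemann sum for `∫ p ^ (n - 1) dp = 1 / n`, so each block wins with probability at most
about `1 / n`, ties included (`eventually_measureReal_forall_pathSup_le`). A gap loses in the same
way against many blocks of its own length. Since all these probabilities cover total mass one, each
block other than the first also receives at least about `1 / n` (`exists_eventually_block`).

Geometric half. If the location over a large window falls in a smaller one, it is also the location
over the smaller one. By stationarity, the mass of a short interval therefore only grows when the
window shrinks around it (`measureReal_leftmostSupLoc_le_of_window`). Compare a short interval in
`[0, T]` with all its translates inside one macroscopic block of a slightly shorter, or slightly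
longer, window. Its mass per unit length is then at most, or at least, the average over the block,
which is close to `1 / T`. Cutting an arbitrary interval into such short pieces gives
`eventually_measureReal_locEvent`, with a relative error independent of the length of the interval.
-/

lemma exists_eq_pathSup (hx : UpperSemicontinuous x) (hab : a ≤ b) :
    ∃ t ∈ Icc a b, x t = pathSup x a b ∧ ∀ s ∈ Icc a b, x s ≤ x t := by
  obtain ⟨t, ht, hmax⟩ := (hx.upperSemicontinuousOn (Icc a b)).exists_isMaxOn
    (nonempty_Icc.2 hab) isCompact_Icc
  refine ⟨t, ht, ?_, fun s hs => hmax hs⟩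
  have : IsGreatest (x '' Icc a b) (x t) :=
    ⟨mem_image_of_mem x ht, by rintro _ ⟨s, hs, rfl⟩; exact hmax hs⟩
  exact this.csSup_eq.symm

lemma le_pathSup (hx : UpperSemicontinuous x) {t : ℝ} (ht : t ∈ Icc a b) :
    x t ≤ pathSup x a b := by
  obtain ⟨s, -, hs, h⟩ := exists_eq_pathSup hx (ht.1.trans ht.2)
  exact (h t ht).trans hs.le

lemma lt_pathSup_iff (hx : UpperSemicontinuous x) (hab : a ≤ b) {y : ℝ} :
    y < pathSup x a b ↔ ∃ t ∈ Icc a b, y < x t := by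
  constructor
  · intro h
    obtain ⟨t, ht, e, -⟩ := exists_eq_pathSup hx hab
    exact ⟨t, ht, e ▸ h⟩
  · rintro ⟨t, ht, h⟩
    exact h.trans_le (le_pathSup hx ht)

lemma pathSup_mono (hx : UpperSemicontinuous x) (hau : a ≤ u) (huv : u ≤ v) (hvb : v ≤ b) :
    pathSup x u v ≤ pathSup x a b := by
  obtain ⟨t, ht, e, -⟩ := exists_eq_pathSup hx huv
  rw [← e]
  exact le_pathSup hx ⟨hau.trans ht.1, ht.2.trans hvb⟩

lemma leftmostSupLoc_mem (hx : UpperSemicontinuous x) (hab : a ≤ b) :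
    leftmostSupLoc x a b ∈ {t ∈ Icc a b | x t = pathSup x a b} := by
  have hset : {t ∈ Icc a b | x t = pathSup x a b} = Icc a b ∩ x ⁻¹' Ici (pathSup x a b) := by
    ext t
    simp only [mem_ofPred_eq, mem_inter_iff, mem_preimage, mem_Ici]
    exact ⟨fun h => ⟨h.1, h.2.ge⟩, fun h => ⟨h.1, le_antisymm (le_pathSup hx h.1) h.2⟩⟩
  have hne : {t ∈ Icc a b | x t = pathSup x a b}.Nonempty := by
    obtain ⟨t, ht, e, -⟩ := exists_eq_pathSup hx hab
    exact ⟨t, ht, e⟩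
  have hc : IsCompact {t ∈ Icc a b | x t = pathSup x a b} := by
    rw [hset]
    exact isCompact_Icc.inter_right (hx.isClosed_preimage _)
  exact hc.sInf_mem hne

lemma leftmostSupLoc_le {t : ℝ} (ht : t ∈ Icc a b) (e : x t = pathSup x a b) :
    leftmostSupLoc x a b ≤ t :=
  csInf_le ⟨a, fun _ hs => hs.1.1⟩ ⟨ht, e⟩

/-- Choosing the leftmost maximiser resolves ties in favour of the left part. The distribution
function of the location thus becomes a comparison of two suprema, through which measurability and
shift invariance are obtained. -/
lemma leftmostSupLoc_le_iff (hx : UpperSemicontinuous x) (hav : a ≤ v) (hvb : v ≤ b) :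
    leftmostSupLoc x a b ≤ v ↔ pathSup x v b ≤ pathSup x a v := by
  obtain ⟨hL, eL⟩ := leftmostSupLoc_mem hx (hav.trans hvb)
  constructor
  · intro h
    exact (pathSup_mono hx hav hvb le_rfl).trans (eL ▸ le_pathSup hx ⟨hL.1, h⟩)
  · intro h
    obtain ⟨t, ht, e, -⟩ := exists_eq_pathSup hx hav
    refine (leftmostSupLoc_le ⟨ht.1, ht.2.trans hvb⟩ ?_).trans ht.2
    refine le_antisymm (le_pathSup hx ⟨ht.1, ht.2.trans hvb⟩) ?_
    rw [← eL, e]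
    rcases le_total (leftmostSupLoc x a b) v with h' | h'
    · exact le_pathSup hx ⟨hL.1, h'⟩
    · exact (le_pathSup hx ⟨h', hL.2⟩).trans h

lemma leftmostSupLoc_eq_of_mem (hx : UpperSemicontinuous x) (hau : a ≤ u) (hvb : v ≤ b)
    (h : leftmostSupLoc x a b ∈ Icc u v) : leftmostSupLoc x u v = leftmostSupLoc x a b := by
  have huv := h.1.trans h.2
  obtain ⟨hL, eL⟩ := leftmostSupLoc_mem hx ((hau.trans huv).trans hvb)
  obtain ⟨hL', eL'⟩ := leftmostSupLoc_mem hx huv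
  have e : pathSup x u v = pathSup x a b :=
    le_antisymm (pathSup_mono hx hau huv hvb) (eL ▸ le_pathSup hx h)
  refine le_antisymm (leftmostSupLoc_le h (eL.trans e.symm)) ?_
  exact leftmostSupLoc_le ⟨hau.trans hL'.1, hL'.2.trans hvb⟩ (eL'.trans e)

lemma pathSup_le_of_leftmostSupLoc_mem (hx : UpperSemicontinuous x) {c d : ℝ} (hac : a ≤ c)
    (hcd : c ≤ d) (hdb : d ≤ b) (hab : a ≤ b) (h : leftmostSupLoc x a b ∈ Icc u v) :
    pathSup x c d ≤ pathSup x u v := by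
  obtain ⟨-, eL⟩ := leftmostSupLoc_mem hx hab
  exact (pathSup_mono hx hac hcd hdb).trans (eL ▸ le_pathSup hx h)

end Path

/-! ### Measurability and shift invariance -/

variable {Ω : Type*} [MeasurableSpace Ω]

/-- A separable stationary process with measurable marginals and upper semicontinuous paths. -/
structure IsRegularStationary (X : ℝ → Ω → ℝ) (P : Measure Ω) : Prop where
  measurable : ∀ t, Measurable (X t)
  usc : ∀ ω, UpperSemicontinuous (fun t => X t ω)
  separable : IsSeparableProcess X P
  stationary : IsStationary X P

variable {X : ℝ → Ω → ℝ} {P : Measure Ω}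

lemma IsSeparableProcess.exists_countable (h : IsSeparableProcess X P) :
    ∃ D : Set ℝ, D.Countable ∧ ∀ᵐ ω ∂P, ∀ u v y : ℝ, ∀ t ∈ Ioo u v, y < X t ω →
      ∃ s ∈ D ∩ Ioo u v, y < X s ω := by
  obtain ⟨D, hD, h⟩ := h
  refine ⟨D, hD, ?_⟩
  filter_upwards [h] with ω hω u v y t ht hy
  have hU : IsOpen (Ioo u v ×ˢ Ioi y) := isOpen_Ioo.prod isOpen_Ioi
  obtain ⟨_, hp, s, hs, rfl⟩ := mem_closure_iff.1 (hω t) _ hU ⟨ht, hy⟩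
  exact ⟨s, ⟨hs, hp.1⟩, hp.2⟩

lemma pathSup_eq_sSup_image {x : ℝ → ℝ} (hx : UpperSemicontinuous x) {a b : ℝ} (hab : a ≤ b)
    {D C : Set ℝ} (hD : ∀ u v y : ℝ, ∀ t ∈ Ioo u v, y < x t → ∃ s ∈ D ∩ Ioo u v, y < x s)
    (hC : C ⊆ Icc a b) (haC : a ∈ C) (hbC : b ∈ C) (hDC : D ∩ Ioo a b ⊆ C) :
    pathSup x a b = sSup (x '' C) := by
  have hbdd : BddAbove (x '' C) := by
    refine ⟨pathSup x a b, ?_⟩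
    rintro _ ⟨s, hs, rfl⟩
    exact le_pathSup hx (hC hs)
  refine le_antisymm (le_of_forall_lt fun y hy => ?_) ?_
  · obtain ⟨t, ht, hyt⟩ := (lt_pathSup_iff hx hab).1 hy
    have key : ∃ s ∈ C, y < x s := by
      rcases eq_or_lt_of_le ht.1 with rfl | h1
      · exact ⟨_, haC, hyt⟩
      rcases eq_or_lt_of_le ht.2 with rfl | h2
      · exact ⟨_, hbC, hyt⟩
      obtain ⟨s, hs, hys⟩ := hD a b y t ⟨h1, h2⟩ hyt
      exact ⟨s, hDC hs, hys⟩
    obtain ⟨s, hs, hys⟩ := key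
    exact hys.trans_le (le_csSup hbdd (mem_image_of_mem x hs))
  · refine csSup_le ⟨_, mem_image_of_mem x haC⟩ ?_
    rintro _ ⟨s, hs, rfl⟩
    exact le_pathSup hx (hC hs)

namespace IsRegularStationary

/-- A single countable set of times serves both the window and its translate, so stationarity can be
applied to one measurable functional of the path. It contains the separating set and its translate
back by `h`. The end points are added because separability controls only the interior of the window:
approximating times for an end point may lie outside. -/
lemma exists_skeleton (hX : IsRegularStationary X P) {a b : ℝ} (hab : a ≤ b) (h : ℝ) :
    ∃ C : Set ℝ, C.Countable ∧ C ⊆ Icc a b ∧ C.Nonempty ∧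
      (∀ᵐ ω ∂P, pathSup (fun t => X t ω) a b = sSup ((fun t => X t ω) '' C)) ∧
      ∀ᵐ ω ∂P, pathSup (fun t => X t ω) (a + h) (b + h) = sSup ((fun t => X (t + h) ω) '' C) := by
  obtain ⟨D, hD, hsep⟩ := hX.separable.exists_countable
  have hinj : Function.Injective (fun t : ℝ => t + h) := add_left_injective h
  refine ⟨{a, b} ∪ (D ∪ (fun t => t + h) ⁻¹' D) ∩ Icc a b, ?_, ?_, ⟨a, by simp⟩, ?_, ?_⟩
  · exact ((countable_singleton b).insert a).union
      ((hD.union (hD.preimage_of_injOn hinj.injOn)).mono inter_subset_left)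
  · rintro t (ht | ht)
    · rcases ht with rfl | rfl
      · exact ⟨le_rfl, hab⟩
      · exact ⟨hab, le_rfl⟩
    · exact ht.2
  · filter_upwards [hsep] with ω hω
    refine pathSup_eq_sSup_image (hX.usc ω) hab hω ?_ (by simp) (by simp) ?_
    · rintro t (ht | ht)
      · rcases ht with rfl | rfl
        · exact ⟨le_rfl, hab⟩
        · exact ⟨hab, le_rfl⟩
      · exact ht.2
    · exact fun t ht => Or.inr ⟨Or.inl ht.1, Ioo_subset_Icc_self ht.2⟩
  · filter_upwards [hsep] with ω hω
    have := pathSup_eq_sSup_image (hX.usc ω) (add_le_add_left hab h) hω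
      (C := (fun t => t + h) '' ({a, b} ∪ (D ∪ (fun t => t + h) ⁻¹' D) ∩ Icc a b)) ?_ ?_ ?_ ?_
    · rw [this, image_image]
    · rintro _ ⟨t, ht | ht, rfl⟩
      · rcases ht with rfl | rfl <;> constructor <;> simp [hab]
      · exact ⟨add_le_add_left ht.2.1 h, add_le_add_left ht.2.2 h⟩
    · exact ⟨a, by simp⟩
    · exact ⟨b, by simp⟩
    · rintro t ⟨htD, ht⟩
      refine ⟨t - h, Or.inr ⟨Or.inr (by simpa using htD), ?_⟩, by simp⟩
      constructor <;> linarith [ht.1, ht.2]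

lemma aemeasurable_pathSup (hX : IsRegularStationary X P) {a b : ℝ} (hab : a ≤ b) :
    AEMeasurable (fun ω => pathSup (fun t => X t ω) a b) P := by
  obtain ⟨C, hC, -, -, h, -⟩ := hX.exists_skeleton hab 0
  exact ⟨_, Measurable.sSup hC fun t _ => hX.measurable t, h⟩

lemma identDistrib_pathSup_prod (hX : IsRegularStationary X P) {a b c d : ℝ} (hab : a ≤ b)
    (hcd : c ≤ d) (h : ℝ) :
    IdentDistrib
      (fun ω => (pathSup (fun t => X t ω) (a + h) (b + h), pathSup (fun t => X t ω) (c + h) (d + h)))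
      (fun ω => (pathSup (fun t => X t ω) a b, pathSup (fun t => X t ω) c d)) P P := by
  obtain ⟨C, hC, -, -, h1, h2⟩ := hX.exists_skeleton hab h
  obtain ⟨E, hE, -, -, h3, h4⟩ := hX.exists_skeleton hcd h
  have hm : Measurable fun f : ℝ → ℝ => (sSup (f '' C), sSup (f '' E)) :=
    (Measurable.sSup hC fun t _ => measurable_pi_apply t).prodMk
      (Measurable.sSup hE fun t _ => measurable_pi_apply t)
  have key := (hX.stationary h).comp hm
  refine (IdentDistrib.of_ae_eq ?_ ?_).trans (key.trans (IdentDistrib.of_ae_eq ?_ ?_))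
  · exact ((hX.aemeasurable_pathSup (add_le_add_left hab h)).prodMk
      (hX.aemeasurable_pathSup (add_le_add_left hcd h)))
  · filter_upwards [h2, h4] with ω e1 e2
    simp [e1, e2]
  · exact key.aemeasurable_snd
  · filter_upwards [h1, h3] with ω e1 e2
    simp [e1, e2]

lemma measureReal_pathSup_mem (hX : IsRegularStationary X P) {a b : ℝ} (hab : a ≤ b)
    (h : ℝ) {s : Set ℝ} (hs : MeasurableSet s) :
    P.real {ω | pathSup (fun t => X t ω) (a + h) (b + h) ∈ s} =
      P.real {ω | pathSup (fun t => X t ω) a b ∈ s} := by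
  have := ((hX.identDistrib_pathSup_prod hab hab h).comp measurable_fst).measure_mem_eq hs
  exact congrArg ENNReal.toReal this

lemma measureReal_leftmostSupLoc_le (hX : IsRegularStationary X P) {a b v : ℝ} (hav : a ≤ v)
    (hvb : v ≤ b) (h : ℝ) :
    P.real {ω | leftmostSupLoc (fun t => X t ω) (a + h) (b + h) ≤ v + h} =
      P.real {ω | leftmostSupLoc (fun t => X t ω) a b ≤ v} := by
  have hs : MeasurableSet {p : ℝ × ℝ | p.1 ≤ p.2} := measurableSet_le measurable_fst measurable_snd
  have := (hX.identDistrib_pathSup_prod hvb hav h).measure_mem_eq hs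
  simp_rw [fun ω => leftmostSupLoc_le_iff (hX.usc ω) hav hvb,
    fun ω => leftmostSupLoc_le_iff (hX.usc ω) (add_le_add_left hav h) (add_le_add_left hvb h)]
  exact congrArg ENNReal.toReal this

lemma nullMeasurable_leftmostSupLoc (hX : IsRegularStationary X P) {a b : ℝ} (hab : a ≤ b) :
    NullMeasurable (fun ω => leftmostSupLoc (fun t => X t ω) a b) P := by
  have key : ∀ v, NullMeasurableSet {ω | leftmostSupLoc (fun t => X t ω) a b ≤ v} P := by
    intro v
    rcases lt_or_ge v a with hv | hav
    · convert nullMeasurableSet_empty using 1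
      refine eq_empty_of_forall_notMem fun ω hω => ?_
      exact (hv.trans_le (leftmostSupLoc_mem (hX.usc ω) hab).1.1).not_ge hω
    rcases lt_or_ge b v with hv | hvb
    · convert nullMeasurableSet_univ using 1
      refine eq_univ_of_forall fun ω => ?_
      exact (leftmostSupLoc_mem (hX.usc ω) hab).1.2.trans hv.le
    simp_rw [fun ω => leftmostSupLoc_le_iff (hX.usc ω) hav hvb]
    exact nullMeasurableSet_le (hX.aemeasurable_pathSup hvb) (hX.aemeasurable_pathSup hav)
  exact measurable_of_Iic (δ := NullMeasurableSpace Ω P) key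

lemma nullMeasurableSet_leftmostSupLoc (hX : IsRegularStationary X P) {a b : ℝ} (hab : a ≤ b)
    {s : Set ℝ} (hs : MeasurableSet s) :
    NullMeasurableSet {ω | leftmostSupLoc (fun t => X t ω) a b ∈ s} P :=
  hX.nullMeasurable_leftmostSupLoc hab hs

lemma measureReal_leftmostSupLoc_Ioc_eq_sub (hX : IsRegularStationary X P) [IsFiniteMeasure P]
    {a b u v : ℝ} (hab : a ≤ b) (huv : u ≤ v) :
    P.real {ω | leftmostSupLoc (fun t => X t ω) a b ∈ Ioc u v} =
      P.real {ω | leftmostSupLoc (fun t => X t ω) a b ≤ v} -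
      P.real {ω | leftmostSupLoc (fun t => X t ω) a b ≤ u} := by
  have h1 := measureReal_inter_add_sdiff₀ (μ := P)
    (s := {ω | leftmostSupLoc (fun t => X t ω) a b ≤ v})
    (hX.nullMeasurableSet_leftmostSupLoc hab (measurableSet_Iic (a := u)))
  have h2 : {ω | leftmostSupLoc (fun t => X t ω) a b ≤ v} ∩
      {ω | leftmostSupLoc (fun t => X t ω) a b ∈ Iic u} =
      {ω | leftmostSupLoc (fun t => X t ω) a b ≤ u} := by
    ext ω
    exact ⟨fun hω => hω.2, fun hω => ⟨le_trans hω huv, hω⟩⟩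
  have h3 : {ω | leftmostSupLoc (fun t => X t ω) a b ≤ v} \
      {ω | leftmostSupLoc (fun t => X t ω) a b ∈ Iic u} =
      {ω | leftmostSupLoc (fun t => X t ω) a b ∈ Ioc u v} := by
    ext ω
    simp [and_comm]
  rw [h2, h3] at h1
  linarith

lemma measureReal_leftmostSupLoc_Ioc (hX : IsRegularStationary X P) [IsFiniteMeasure P]
    {a b u v : ℝ} (hau : a ≤ u) (huv : u ≤ v) (hvb : v ≤ b) (h : ℝ) :
    P.real {ω | leftmostSupLoc (fun t => X t ω) (a + h) (b + h) ∈ Ioc (u + h) (v + h)} =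
      P.real {ω | leftmostSupLoc (fun t => X t ω) a b ∈ Ioc u v} := by
  have hab : a ≤ b := hau.trans (huv.trans hvb)
  rw [hX.measureReal_leftmostSupLoc_Ioc_eq_sub (by linarith) (by linarith),
    hX.measureReal_leftmostSupLoc_Ioc_eq_sub hab huv,
    hX.measureReal_leftmostSupLoc_le (hau.trans huv) hvb,
    hX.measureReal_leftmostSupLoc_le hau (huv.trans hvb)]

/-- Enlarging the window decreases the probability that the supremum location falls into a given
interval; both windows may moreover be shifted relative to each other. -/
lemma measureReal_leftmostSupLoc_le_of_window (hX : IsRegularStationary X P) [IsFiniteMeasure P]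
    {a b u a' b' u' e : ℝ} (he : 0 ≤ e) (ha' : a' ≤ u') (hb' : u' + e ≤ b')
    (ha : u' - a' ≤ u - a) (hb : b' - u' ≤ b - u) :
    P.real {ω | leftmostSupLoc (fun t => X t ω) a b ∈ Ioc u (u + e)} ≤
      P.real {ω | leftmostSupLoc (fun t => X t ω) a' b' ∈ Ioc u' (u' + e)} := by
  rw [← hX.measureReal_leftmostSupLoc_Ioc ha' (by linarith) hb' (u - u')]
  refine measureReal_mono fun ω hω => ?_
  have := leftmostSupLoc_eq_of_mem (hX.usc ω) (a := a) (b := b) (u := a' + (u - u'))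
    (v := b' + (u - u')) (by linarith) (by linarith)
    ⟨by linarith [hω.1], by linarith [hω.2]⟩
  rw [mem_ofPred_eq, this]
  exact ⟨by linarith [hω.1], by linarith [hω.2]⟩

end IsRegularStationary

end SupLocation

namespace SupLocation

/-! ### Mixing for finitely many separated blocks -/

variable {Ω : Type*} {X : ℝ → Ω → ℝ}

lemma tailSigma_mono (φ : ℝ) {S T : Set ℝ} (h : S ⊆ T) : tailSigma X φ S ≤ tailSigma X φ T :=
  biSup_mono h

/-- Realises tail events at shifted times as preimages of events on path space, where stationarity
acts. -/
lemma comap_tailSigma_eval (c φ : ℝ) (S : Set ℝ) :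
    MeasurableSpace.comap (fun ω (t : ℝ) => X (t + c) ω)
      (tailSigma (fun (t : ℝ) (f : ℝ → ℝ) => f t) φ S) =
    tailSigma X φ ((fun t => t + c) '' S) := by
  simp only [tailSigma, MeasurableSpace.comap_iSup, MeasurableSpace.comap_comp, iSup_image]
  rfl

variable [MeasurableSpace Ω] {P : Measure Ω}

lemma tailSigma_le (hX : ∀ t, Measurable (X t)) (φ : ℝ) (S : Set ℝ) :
    tailSigma X φ S ≤ ‹MeasurableSpace Ω› := by
  refine iSup₂_le fun t _ => ?_
  have : Measurable ({ω | φ ≤ X t ω}.indicator (X t)) :=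
    (hX t).indicator (measurableSet_le measurable_const (hX t))
  exact (BorelSpace.measurable_eq (α := ℝ)) ▸ this.comap_le

lemma abs_measureReal_inter_sub_le_one [IsProbabilityMeasure P] (A B : Set Ω) :
    |P.real (A ∩ B) - P.real A * P.real B| ≤ 1 := by
  rw [abs_le]
  have h1 := measureReal_nonneg (μ := P) (s := A ∩ B)
  have h2 := measureReal_le_one (μ := P) (s := A ∩ B)
  have h3 := mul_nonneg (measureReal_nonneg (μ := P) (s := A)) (measureReal_nonneg (μ := P) (s := B))
  have h4 := mul_le_one₀ (measureReal_le_one (μ := P) (s := A)) measureReal_nonneg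
    (measureReal_le_one (μ := P) (s := B))
  constructor <;> linarith

/-- Both events are pulled back from path space along the shifted process; stationarity replaces it
by the unshifted one, for which the pair competes in the supremum defining the coefficient. -/
lemma IsStationary.abs_measureReal_inter_sub_le [IsProbabilityMeasure P] (hX : IsStationary X P)
    {φ s c : ℝ} {A B : Set Ω} (hA : MeasurableSet[tailSigma X φ (Iic c)] A)
    (hB : MeasurableSet[tailSigma X φ (Ici (c + s))] B) :
    |P.real (A ∩ B) - P.real A * P.real B| ≤
      mixingCoeff P (tailSigma X φ (Iic 0)) (tailSigma X φ (Ici s)) := by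
  have e1 : Iic c = (fun t => t + c) '' Iic 0 := by simp
  have e2 : Ici (c + s) = (fun t => t + c) '' Ici s := by simp [add_comm]
  rw [e1, ← comap_tailSigma_eval] at hA
  rw [e2, ← comap_tailSigma_eval] at hB
  obtain ⟨A', hA', rfl⟩ := hA
  obtain ⟨B', hB', rfl⟩ := hB
  have hle := fun S => tailSigma_le (X := fun (t : ℝ) (f : ℝ → ℝ) => f t)
    (fun t => measurable_pi_apply t) φ S
  have key : ∀ U : Set (ℝ → ℝ), MeasurableSet U →
      P.real ((fun ω (t : ℝ) => X (t + c) ω) ⁻¹' U) = P.real ((fun ω (t : ℝ) => X t ω) ⁻¹' U) :=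
    fun U hU => congrArg ENNReal.toReal ((hX c).measure_mem_eq hU)
  have hA'' := hle _ _ hA'
  have hB'' := hle _ _ hB'
  rw [← preimage_inter, key _ hA'', key _ hB'', key _ (hA''.inter hB'')]
  refine le_csSup ⟨1, ?_⟩ ⟨_, _, ?_, ?_, by rw [← preimage_inter]⟩
  · rintro _ ⟨A, B, -, -, rfl⟩
    exact abs_measureReal_inter_sub_le_one A B
  · have := comap_tailSigma_eval (X := X) 0 φ (Iic 0)
    simp only [add_zero, image_id'] at this
    rw [← this]
    exact ⟨A', hA', rfl⟩
  · have := comap_tailSigma_eval (X := X) 0 φ (Ici s)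
    simp only [add_zero, image_id'] at this
    rw [← this]
    exact ⟨B', hB', rfl⟩

lemma abs_prod_sub_prod_le {n : ℕ} {x y : ℕ → ℝ} {ε : ℝ} (hx : ∀ k < n, x k ∈ Icc (0 : ℝ) 1)
    (hy : ∀ k < n, y k ∈ Icc (0 : ℝ) 1) (h : ∀ k < n, |x k - y k| ≤ ε) :
    |∏ k ∈ Finset.range n, x k - ∏ k ∈ Finset.range n, y k| ≤ n * ε := by
  induction n with
  | zero => simp
  | succ n ih =>
    have ih' := ih (fun k hk => hx k (by omega)) (fun k hk => hy k (by omega))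
      (fun k hk => h k (by omega))
    rw [Finset.prod_range_succ, Finset.prod_range_succ]
    set p := ∏ k ∈ Finset.range n, x k
    set q := ∏ k ∈ Finset.range n, y k
    have hq0 : 0 ≤ q := Finset.prod_nonneg fun k hk => (hy k (by simp at hk; omega)).1
    have hq1 : q ≤ 1 := Finset.prod_le_one (fun k hk => (hy k (by simp at hk; omega)).1)
      fun k hk => (hy k (by simp at hk; omega)).2
    have e : p * x n - q * y n = (p - q) * x n + q * (x n - y n) := by ring
    have hxn := hx n (by omega)
    calc |p * x n - q * y n| ≤ |(p - q) * x n| + |q * (x n - y n)| := e ▸ abs_add_le _ _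
      _ = |p - q| * x n + q * |x n - y n| := by
        rw [abs_mul, abs_mul, abs_of_nonneg hxn.1, abs_of_nonneg hq0]
      _ ≤ |p - q| * 1 + 1 * |x n - y n| :=
        add_le_add (mul_le_mul_of_nonneg_left hxn.2 (abs_nonneg _))
          (mul_le_mul_of_nonneg_right hq1 (abs_nonneg _))
      _ ≤ (n + 1 : ℕ) * ε := by
        have := h n (by omega)
        push_cast
        linarith

/-- Splitting off the last block costs one mixing coefficient, because all earlier blocks lie in its
past at distance at least `s`. -/
lemma IsStationary.abs_measureReal_iInter_sub_prod_le [IsProbabilityMeasure P]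
    (hX : IsStationary X P) {φ s : ℝ} {a b : ℕ → ℝ} (hab : ∀ i k, i < k → b i + s ≤ a k)
    {A : ℕ → Set Ω} (hA : ∀ k, MeasurableSet[tailSigma X φ (Icc (a k) (b k))] (A k)) (n : ℕ) :
    |P.real (⋂ k ∈ Finset.range n, A k) - ∏ k ∈ Finset.range n, P.real (A k)| ≤
      n * mixingCoeff P (tailSigma X φ (Iic 0)) (tailSigma X φ (Ici s)) := by
  induction n with
  | zero => simp
  | succ n ih =>
    set α := mixingCoeff P (tailSigma X φ (Iic 0)) (tailSigma X φ (Ici s))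
    have e : (⋂ k ∈ Finset.range (n + 1), A k) = (⋂ k ∈ Finset.range n, A k) ∩ A n := by
      rw [Finset.range_add_one, Finset.set_biInter_insert, inter_comm]
    have h1 : MeasurableSet[tailSigma X φ (Iic (a n - s))] (⋂ k ∈ Finset.range n, A k) := by
      refine Finset.measurableSet_biInter _ fun k hk => ?_
      refine tailSigma_mono φ ?_ _ (hA k)
      intro t ht
      have := hab k n (Finset.mem_range.1 hk)
      exact ht.2.trans (by linarith)
    have h2 : MeasurableSet[tailSigma X φ (Ici (a n - s + s))] (A n) := by
      refine tailSigma_mono φ ?_ _ (hA n)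
      intro t ht
      simpa using ht.1
    have h3 := hX.abs_measureReal_inter_sub_le h1 h2
    rw [e, Finset.prod_range_succ]
    set p := P.real (⋂ k ∈ Finset.range n, A k)
    set q := ∏ k ∈ Finset.range n, P.real (A k)
    have e2 : P.real ((⋂ k ∈ Finset.range n, A k) ∩ A n) - q * P.real (A n) =
      (P.real ((⋂ k ∈ Finset.range n, A k) ∩ A n) - p * P.real (A n)) +
        (p - q) * P.real (A n) := by ring
    rw [e2]
    calc _ ≤ _ := abs_add_le _ _
      _ ≤ α + |p - q| * 1 := by
        refine add_le_add h3 ?_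
        rw [abs_mul, abs_of_nonneg (measureReal_nonneg (μ := P) (s := A n))]
        exact mul_le_mul_of_nonneg_left measureReal_le_one (abs_nonneg _)
      _ ≤ _ := by
        push_cast
        linarith

/-! ### Comparison of nearly independent block maxima -/

/-- An upper Riemann sum for `∫ p ^ n dp` over `[0, 1]`: `hB` bounds the lower sum by telescoping,
and `hA` bounds the difference between the two sums. -/
lemma sum_sub_mul_pow_le {F : ℕ → ℝ} {R : ℕ} {η : ℝ} (hη0 : 0 ≤ η) (hF : Monotone F) (h0 : F 0 = 0)
    (h1 : ∀ i, F i ≤ 1) (hη : ∀ i < R, F (i + 1) - F i ≤ η) (n : ℕ) :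
    ∑ i ∈ Finset.range R, (F (i + 1) - F i) * F (i + 1) ^ n ≤ 1 / (n + 1) + n * η := by
  have hpos : ∀ i, 0 ≤ F i := fun i => h0 ▸ hF (Nat.zero_le i)
  have key : ∀ i < R, (F (i + 1) - F i) * F (i + 1) ^ n ≤
      (F (i + 1) ^ (n + 1) - F i ^ (n + 1)) / (n + 1) + (F (i + 1) - F i) * (n * η) := by
    intro i hi
    have hxy := hF (Nat.le_succ i)
    have hx := hpos i
    have hy1 := h1 (i + 1)
    have hd := hη i hi
    simp only [Nat.succ_eq_add_one] at hxy
    generalize F i = x at *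
    generalize F (i + 1) = y at *
    have hA : ∀ n : ℕ, y ^ n ≤ x ^ n + n * η := by
      intro n
      induction n with
      | zero => simp
      | succ k ih =>
        have hxk : x ^ k ≤ 1 := pow_le_one₀ hx (by linarith)
        have hy0 : 0 ≤ y := by linarith
        calc y ^ (k + 1) = y ^ k * y := pow_succ _ _
          _ ≤ (x ^ k + k * η) * y := mul_le_mul_of_nonneg_right ih hy0
          _ = x ^ (k + 1) + x ^ k * (y - x) + k * η * y := by ring
          _ ≤ x ^ (k + 1) + 1 * η + k * η * 1 := by gcongr
          _ = _ := by push_cast; ring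
    have hB : ∀ n : ℕ, (n + 1) * x ^ n * (y - x) ≤ y ^ (n + 1) - x ^ (n + 1) := by
      intro n
      induction n with
      | zero => simp
      | succ k ih =>
        have hxk : 0 ≤ x ^ (k + 1) := pow_nonneg hx _
        have hk : x ^ (k + 1) ≤ y ^ (k + 1) := pow_le_pow_left₀ hx hxy _
        have e : y ^ (k + 1 + 1) - x ^ (k + 1 + 1) =
          (y ^ (k + 1) - x ^ (k + 1)) * x + y ^ (k + 1) * (y - x) := by ring
        rw [e]
        have t1 := mul_le_mul_of_nonneg_right ih hx
        have t2 := mul_le_mul_of_nonneg_right hk (sub_nonneg.2 hxy)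
        push_cast
        calc _ = (k + 1) * x ^ k * (y - x) * x + x ^ (k + 1) * (y - x) := by ring
          _ ≤ _ := add_le_add t1 t2
    have hB' := hB n
    have hn : (0 : ℝ) < n + 1 := by positivity
    have hC : x ^ n * (y - x) ≤ (y ^ (n + 1) - x ^ (n + 1)) / (n + 1) := by
      rw [le_div_iff₀ hn]
      linarith
    have := mul_le_mul_of_nonneg_left (hA n) (sub_nonneg.2 hxy)
    linarith
  calc _ ≤ ∑ i ∈ Finset.range R, ((F (i + 1) ^ (n + 1) - F i ^ (n + 1)) / (n + 1) +
        (F (i + 1) - F i) * (n * η)) :=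
        Finset.sum_le_sum fun i hi => key i (Finset.mem_range.1 hi)
    _ = (F R ^ (n + 1) - F 0 ^ (n + 1)) / (n + 1) + (F R - F 0) * (n * η) := by
        rw [Finset.sum_add_distrib, ← Finset.sum_div, ← Finset.sum_mul,
          Finset.sum_range_sub (fun i => F i ^ (n + 1)), Finset.sum_range_sub]
    _ ≤ _ := by
        have hR := h1 R
        have hR0 := hpos R
        rw [h0]
        have hp : F R ^ (n + 1) ≤ 1 := pow_le_one₀ hR0 hR
        have : (F R - 0) * (n * η) ≤ n * η := by
          have : 0 ≤ n * η := by positivity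
          nlinarith
        gcongr
        simpa using hp

/-- Think of `A k i` as "maximum `k` is at most level `i`". Outside `B`, the event `E` forces some
`G i \ H i`: all maxima are below level `i + 1`, but maximum `j` is not below level `i`. Approximate
independence is used twice per level, whence the error `2 * R * ε`. -/
lemma measureReal_le_of_nearly_independent [IsProbabilityMeasure P] {n R j : ℕ} (hj : j < n)
    {A : ℕ → ℕ → Set Ω} {F : ℕ → ℝ} {E B : Set Ω} {η ε : ℝ} (hη0 : 0 ≤ η)
    (hmeas : ∀ k i, MeasurableSet (A k i)) (hmono : ∀ k i, A k i ⊆ A k (i + 1))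
    (hF : Monotone F) (h0 : F 0 = 0) (h1 : ∀ i, F i ≤ 1) (hη : ∀ i < R, F (i + 1) - F i ≤ η)
    (hprod : ∀ f : ℕ → ℕ, |P.real (⋂ k ∈ Finset.range n, A k (f k)) -
      ∏ k ∈ Finset.range n, F (f k)| ≤ ε)
    (hE : ∀ᵐ ω ∂P, ω ∈ E → ω ∉ B → ∃ i < R, ω ∉ A j i ∧ ∀ k < n, ω ∈ A k (i + 1)) :
    P.real E ≤ 1 / n + n * η + 2 * R * ε + P.real B := by
  set G : ℕ → Set Ω := fun i => ⋂ k ∈ Finset.range n, A k (i + 1)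
  set H : ℕ → Set Ω := fun i => ⋂ k ∈ Finset.range n, A k (if k = j then i else i + 1)
  have hHG : ∀ i, H i ⊆ G i := by
    intro i
    refine iInter₂_mono fun k _ => ?_
    split_ifs
    · exact hmono k i
    · exact le_rfl
  have hHm : ∀ i, MeasurableSet (H i) := fun i => Finset.measurableSet_biInter _ fun k _ => hmeas _ _
  have hsub : E ≤ᵐ[P] ((⋃ i ∈ Finset.range R, G i \ H i) ∪ B : Set Ω) := by
    filter_upwards [hE] with ω hω hωE
    by_cases hB : ω ∈ B
    · exact Or.inr hB
    obtain ⟨i, hi, h2, h3⟩ := hω hωE hB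
    refine Or.inl (mem_iUnion₂.2 ⟨i, Finset.mem_range.2 hi, ?_, ?_⟩)
    · exact mem_iInter₂.2 fun k hk => h3 k (Finset.mem_range.1 hk)
    · intro hH
      have := mem_iInter₂.1 hH j (Finset.mem_range.2 hj)
      simp only [if_true] at this
      exact h2 this
  have hterm : ∀ i, P.real (G i \ H i) ≤ (F (i + 1) - F i) * F (i + 1) ^ (n - 1) + 2 * ε := by
    intro i
    rw [measureReal_sdiff (hHG i) (hHm i)]
    have g := abs_le.1 (hprod fun _ => i + 1)
    have h := abs_le.1 (hprod fun k => if k = j then i else i + 1)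
    have e1 : ∏ k ∈ Finset.range n, F (i + 1) = F (i + 1) * F (i + 1) ^ (n - 1) := by
      rw [Finset.prod_const, Finset.card_range, ← pow_succ', Nat.sub_add_cancel (by omega)]
    have e2 : ∏ k ∈ Finset.range n, F (if k = j then i else i + 1) =
        F i * F (i + 1) ^ (n - 1) := by
      rw [← Finset.mul_prod_erase _ _ (Finset.mem_range.2 hj), if_pos rfl]
      congr 1
      rw [Finset.prod_congr rfl (g := fun _ => F (i + 1))]
      · rw [Finset.prod_const, Finset.card_erase_of_mem (Finset.mem_range.2 hj), Finset.card_range]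
      · intro k hk
        rw [if_neg (Finset.ne_of_mem_erase hk)]
    rw [e1] at g
    rw [e2] at h
    change P.real (⋂ k ∈ Finset.range n, A k (i + 1)) -
      P.real (⋂ k ∈ Finset.range n, A k (if k = j then i else i + 1)) ≤ _
    linarith [g.2, h.1]
  have hsum := sum_sub_mul_pow_le hη0 hF h0 h1 hη (n - 1)
  calc P.real E ≤ P.real ((⋃ i ∈ Finset.range R, G i \ H i) ∪ B) :=
        ENNReal.toReal_mono (measure_ne_top _ _) (measure_mono_ae hsub)
    _ ≤ P.real (⋃ i ∈ Finset.range R, G i \ H i) + P.real B := measureReal_union_le _ _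
    _ ≤ ∑ i ∈ Finset.range R, P.real (G i \ H i) + P.real B :=
        add_le_add_left (measureReal_biUnion_finset_le _ _) _
    _ ≤ ∑ i ∈ Finset.range R, ((F (i + 1) - F i) * F (i + 1) ^ (n - 1) + 2 * ε) + P.real B :=
        add_le_add_left (Finset.sum_le_sum fun i _ => hterm i) _
    _ ≤ _ := by
        rw [Finset.sum_add_distrib, Finset.sum_const, Finset.card_range, nsmul_eq_mul]
        have e : ((n - 1 : ℕ) : ℝ) = n - 1 := by
          rw [Nat.cast_sub (by omega)]; simp
        rw [e] at hsum
        simp only [sub_add_cancel] at hsum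
        linarith

/-! ### Quantiles -/

/-- At the infimum of `{x | p ≤ cdf ν x}` the distribution function overshoots `p` by at most the
atom there. -/
lemma exists_quantile (ν : Measure ℝ) [IsProbabilityMeasure ν] {δ p : ℝ}
    (hδ : ∀ x, ν.real {x} ≤ δ) (hp0 : 0 < p) (hp1 : p < 1) :
    ∃ y, p ≤ ν.real (Iic y) ∧ ν.real (Iic y) ≤ p + δ := by
  set S := {x | p ≤ cdf ν x}
  have hne : S.Nonempty := ((tendsto_cdf_atTop ν).eventually (eventually_ge_nhds hp1)).exists
  obtain ⟨z, hz⟩ := ((tendsto_cdf_atBot ν).eventually (eventually_lt_nhds hp0)).exists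
  have hbdd : BddBelow S := ⟨z, fun x hx => by
    by_contra h
    exact absurd ((monotone_cdf ν (not_le.1 h).le).trans_lt hz) (not_lt.2 hx)⟩
  refine ⟨sInf S, ?_, ?_⟩
  · rw [← cdf_eq_real]
    have hr := (cdf ν).right_continuous (sInf S)
    refine ge_of_tendsto (hr.mono_left (nhdsWithin_mono _ Ioi_subset_Ici_self)) ?_
    filter_upwards [self_mem_nhdsWithin] with x hx
    obtain ⟨w, hw, hwx⟩ := exists_lt_of_csInf_lt hne hx
    exact le_trans hw (monotone_cdf ν hwx.le)
  · have h1 : ν.real (Iio (sInf S)) ≤ p := by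
      have hl : (cdf ν).measure (Iio (sInf S)) ≤ ENNReal.ofReal p := by
        rw [(cdf ν).measure_Iio (tendsto_cdf_atBot ν)]
        refine ENNReal.ofReal_le_ofReal ?_
        rw [sub_zero]
        refine le_of_tendsto ((monotone_cdf ν).tendsto_leftLim (sInf S)) ?_
        filter_upwards [self_mem_nhdsWithin] with x hx
        by_contra h
        exact absurd (csInf_le hbdd (show x ∈ S from (not_le.1 h).le)) (not_le.2 hx)
      rw [measure_cdf] at hl
      exact ENNReal.toReal_le_of_le_ofReal hp0.le hl
    have h2 : Iic (sInf S) = Iio (sInf S) ∪ {sInf S} := by simp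
    rw [h2]
    linarith [measureReal_union_le (μ := ν) (Iio (sInf S)) {sInf S}, hδ (sInf S)]

end SupLocation

namespace SupLocation

/-! ### Asymptotic exchangeability of separated block maxima -/

variable {Ω : Type*} [MeasurableSpace Ω] {X : ℝ → Ω → ℝ} {P : Measure Ω}

namespace IsRegularStationary

/-- Exceedances of levels above the truncation level are events of the truncated process, up to
the event that the supremum is zero. -/
lemma exists_tail_event (hX : IsRegularStationary X P) {a b : ℝ} (hab : a ≤ b) :
    ∃ N : ℝ → Set Ω, (∀ y y', y ≤ y' → N y' ⊆ N y) ∧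
      (∀ φ y, φ ≤ y → MeasurableSet[tailSigma X φ (Icc a b)] (N y)) ∧
      ∀ᵐ ω ∂P, ∀ y, (ω ∈ N y → y < pathSup (fun t => X t ω) a b) ∧
        (y < pathSup (fun t => X t ω) a b → ω ∈ N y ∨ pathSup (fun t => X t ω) a b = 0) := by
  obtain ⟨C, hC, hCab, hCne, h, -⟩ := hX.exists_skeleton hab 0
  -- The truncated variable is `0` both when `X t < φ` and when `X t = 0`. Excluding the value `0`
  -- removes the ambiguity for negative `y`, and matters only when the supremum itself is `0`.
  refine ⟨fun y => ⋃ t ∈ C, {ω | y < X t ω ∧ X t ω ≠ 0}, ?_, ?_, ?_⟩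
  · intro y y' hy
    exact iUnion₂_mono fun t _ ω hω => ⟨hy.trans_lt hω.1, hω.2⟩
  · intro φ y hy
    refine MeasurableSet.biUnion hC fun t ht => ?_
    have hle : MeasurableSpace.comap ({ω | φ ≤ X t ω}.indicator (X t)) (borel ℝ) ≤
        tailSigma X φ (Icc a b) :=
      le_biSup (fun s => MeasurableSpace.comap ({ω | φ ≤ X s ω}.indicator (X s)) (borel ℝ))
        (hCab ht)
    refine hle _ ⟨Ioi y ∩ {0}ᶜ, ?_, ?_⟩
    · rw [← BorelSpace.measurable_eq (α := ℝ)]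
      exact measurableSet_Ioi.inter (measurableSet_singleton 0).compl
    · ext ω
      by_cases hω : φ ≤ X t ω
      · have : ({ω | φ ≤ X t ω}.indicator (X t)) ω = X t ω := indicator_of_mem (by exact hω) _
        simp only [mem_preimage, this]
        rfl
      · have : ({ω | φ ≤ X t ω}.indicator (X t)) ω = 0 := indicator_of_notMem (by exact hω) _
        simp only [mem_preimage, this, mem_inter_iff, mem_compl_iff, mem_singleton_iff,
          not_true_eq_false, and_false, false_iff, mem_ofPred_eq, not_and]
        intro h1
        exact absurd (hy.trans h1.le) hω
  · filter_upwards [h] with ω hω y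
    constructor
    · intro hy
      obtain ⟨t, ht, hyt, -⟩ := mem_iUnion₂.1 hy
      exact hyt.trans_le (le_pathSup (hX.usc ω) (hCab ht))
    · intro hy
      have key : ∀ z < pathSup (fun t => X t ω) a b, ∃ t ∈ C, z < X t ω := by
        intro z hz
        rw [hω] at hz
        obtain ⟨_, ⟨t, ht, rfl⟩, hzt⟩ := exists_lt_of_lt_csSup (hCne.image _) hz
        exact ⟨t, ht, hzt⟩
      by_contra! hcon
      obtain ⟨h1, h2⟩ := hcon
      have h3 : ∀ t ∈ C, y < X t ω → X t ω = 0 := by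
        intro t ht hyt
        by_contra h0
        exact h1 (mem_iUnion₂.2 ⟨t, ht, hyt, h0⟩)
      obtain ⟨t, ht, hyt⟩ := key y hy
      have h4 : 0 ≤ pathSup (fun t => X t ω) a b :=
        h3 t ht hyt ▸ le_pathSup (hX.usc ω) (hCab ht)
      have h5 := lt_of_le_of_ne h4 (Ne.symm h2)
      obtain ⟨t', ht', hyt'⟩ := key (max y 0) (max_lt hy h5)
      have h6 := h3 t' ht' ((le_max_left _ _).trans_lt hyt')
      exact absurd ((le_max_right y 0).trans_lt hyt') (by rw [h6]; simp)

lemma measureReal_forall_pathSup_le (hX : IsRegularStationary X P) [IsProbabilityMeasure P]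
    {a b : ℕ → ℝ} {s ℓ φ δ : ℝ} {n R j : ℕ} (hj : j < n) (hR : 0 < R)
    (hsep : ∀ i k, i < k → b i + s ≤ a k) (hℓ : 0 ≤ ℓ) (hlen : ∀ k, b k = a k + ℓ)
    (hδ : ∀ x, P.real {ω | pathSup (fun t => X t ω) 0 ℓ = x} ≤ δ) (hδR : δ < 1 / R)
    (hφ : P.real {ω | pathSup (fun t => X t ω) 0 ℓ ≤ φ} < 1 / R) :
    P.real {ω | ∀ k < n, pathSup (fun t => X t ω) (a k) (b k) ≤
        pathSup (fun t => X t ω) (a j) (b j)} ≤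
      1 / n + n * (2 / R) + 2 * R *
        (n * mixingCoeff P (tailSigma X φ (Iic 0)) (tailSigma X φ (Ici s)) + n * δ) + n * δ := by
  have hR0 : (0 : ℝ) < R := by exact_mod_cast hR
  have hδ0 : 0 ≤ δ := measureReal_nonneg.trans (hδ 0)
  set M : ℕ → Ω → ℝ := fun k ω => pathSup (fun t => X t ω) (a k) (b k) with hM
  have hlaw : ∀ k, ∀ S : Set ℝ, MeasurableSet S → P.real {ω | M k ω ∈ S} =
      P.real {ω | pathSup (fun t => X t ω) 0 ℓ ∈ S} := by
    intro k S hS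
    have := hX.measureReal_pathSup_mem hℓ (a k) hS
    rw [zero_add, add_comm ℓ, ← hlen k] at this
    exact this
  have hatom : ∀ k x, P.real {ω | M k ω = x} ≤ δ := fun k x =>
    (hlaw k {x} (measurableSet_singleton x)).trans_le (hδ x)
  set ν := P.map (fun ω => pathSup (fun t => X t ω) 0 ℓ) with hν
  have hae := hX.aemeasurable_pathSup hℓ
  have : IsProbabilityMeasure ν := Measure.isProbabilityMeasure_map hae
  have hνS : ∀ S : Set ℝ, MeasurableSet S →
      ν.real S = P.real {ω | pathSup (fun t => X t ω) 0 ℓ ∈ S} := by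
    intro S hS
    exact congrArg ENNReal.toReal (Measure.map_apply_of_aemeasurable hae hS)
  -- Only the levels `0 < i < R` are genuine quantiles; the value `0` elsewhere is never used.
  have hq : ∀ i : ℕ, ∃ y, 0 < i ∧ i < R → (i : ℝ) / R ≤ ν.real (Iic y) ∧
      ν.real (Iic y) ≤ i / R + δ := by
    intro i
    by_cases hi : 0 < i ∧ i < R
    · have h1 : (0 : ℝ) < i := by exact_mod_cast hi.1
      have h2 : (i : ℝ) < R := by exact_mod_cast hi.2
      obtain ⟨y, hy⟩ := exists_quantile ν (δ := δ) (p := i / R)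
        (fun x => (hνS _ (measurableSet_singleton x)).trans_le (hδ x)) (by positivity)
        ((div_lt_one hR0).2 h2)
      exact ⟨y, fun _ => hy⟩
    · exact ⟨0, fun h => absurd h hi⟩
  choose y hy using hq
  have hstep : ∀ i : ℕ, (i : ℝ) / R + δ < ((i + 1 : ℕ) : ℝ) / R := by
    intro i
    push_cast
    rw [add_div]
    linarith
  -- Already the first quantile lies above the truncation level, so every level used gives a tail
  -- event.
  have hφy : ∀ i, 0 < i → i < R → φ ≤ y i := by
    intro i h0 hi
    by_contra h
    have h1 : ν.real (Iic (y i)) ≤ ν.real (Iic φ) := measureReal_mono (Iic_subset_Iic.2 (not_le.1 h).le)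
    have h2 : ν.real (Iic φ) < 1 / R := (hνS _ measurableSet_Iic).trans_lt hφ
    have h3 : (1 : ℝ) / R ≤ i / R := by
      gcongr
      exact_mod_cast h0
    linarith [(hy i ⟨h0, hi⟩).1]
  have hymono : ∀ i, 0 < i → i + 1 < R → y i ≤ y (i + 1) := by
    intro i h0 hi
    by_contra h
    have h1 : ν.real (Iic (y (i + 1))) ≤ ν.real (Iic (y i)) :=
      measureReal_mono (Iic_subset_Iic.2 (not_le.1 h).le)
    linarith [(hy i ⟨h0, by omega⟩).2, (hy (i + 1) ⟨by omega, hi⟩).1, hstep i]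
  -- The conventions at `i = 0` and `i ≥ R` stand for the levels `-∞` and `+∞`; `A` below follows
  -- the same pattern.
  set F : ℕ → ℝ := fun i => if i = 0 then 0 else if i < R then ν.real (Iic (y i)) else 1 with hF
  have hF0 : F 0 = 0 := by simp [hF]
  have hF1 : ∀ i, F i ≤ 1 := by
    intro i
    simp only [hF]
    split_ifs
    · exact zero_le_one
    · exact measureReal_le_one
    · exact le_rfl
  have hFR : ∀ i, R ≤ i → F i = 1 := by
    intro i hi
    simp only [hF]
    rw [if_neg (by omega), if_neg (by omega)]
  have hFb : ∀ i ≤ R, (i : ℝ) / R ≤ F i ∧ F i ≤ i / R + δ := by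
    intro i hi
    rcases Nat.eq_zero_or_pos i with rfl | h0
    · simp [hF0, hδ0]
    rcases hi.lt_or_eq with h | rfl
    · simp only [hF]
      rw [if_neg (by omega), if_pos h]
      exact hy i ⟨h0, h⟩
    · rw [hFR i le_rfl, div_self hR0.ne']
      exact ⟨le_rfl, by linarith⟩
  have hFmono : Monotone F := by
    refine monotone_nat_of_le_succ fun i => ?_
    rcases lt_or_ge i R with h | h
    · linarith [(hFb i h.le).2, hstep i, (hFb (i + 1) h).1]
    · rw [hFR i h, hFR _ (h.trans (Nat.le_succ i))]
  have hFjump : ∀ i < R, F (i + 1) - F i ≤ 2 / R := by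
    intro i h
    have h1 := (hFb (i + 1) h).2
    have h2 := (hFb i h.le).1
    have e : ((i + 1 : ℕ) : ℝ) / R = i / R + 1 / R := by push_cast; rw [add_div]
    have e2 : (2 : ℝ) / R = 1 / R + 1 / R := by rw [← add_div]; norm_num
    linarith
  have hab : ∀ k, a k ≤ b k := fun k => by rw [hlen k]; linarith
  choose N hNanti hNmeas hNae using fun k => hX.exists_tail_event (hab k)
  set A : ℕ → ℕ → Set Ω := fun k i => if i = 0 then ∅ else if i < R then (N k (y i))ᶜ else univ
    with hA
  have hAR : ∀ k i, R ≤ i → A k i = univ := by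
    intro k i hi
    simp only [hA]
    rw [if_neg (by omega), if_neg (by omega)]
  have hAN : ∀ k i, 0 < i → i < R → A k i = (N k (y i))ᶜ := by
    intro k i h0 hi
    simp only [hA]
    rw [if_neg (by omega), if_pos hi]
  have hAmeas : ∀ k i, MeasurableSet[tailSigma X φ (Icc (a k) (b k))] (A k i) := by
    intro k i
    simp only [hA]
    split_ifs with h0 h1
    · exact @MeasurableSet.empty _ (tailSigma X φ (Icc (a k) (b k)))
    · exact (hNmeas k φ (y i) (hφy i (by omega) h1)).compl
    · exact @MeasurableSet.univ _ (tailSigma X φ (Icc (a k) (b k)))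
  have hAmono : ∀ k i, A k i ⊆ A k (i + 1) := by
    intro k i
    rcases Nat.eq_zero_or_pos i with rfl | h0
    · simp [hA]
    rcases lt_or_ge (i + 1) R with h | h
    · rw [hAN k i h0 (by omega), hAN k (i + 1) (by omega) h]
      exact compl_subset_compl.2 (hNanti k _ _ (hymono i h0 h))
    · rw [hAR k _ h]
      exact subset_univ _
  have hAF : ∀ k i, |P.real (A k i) - F i| ≤ δ := by
    intro k i
    rcases Nat.eq_zero_or_pos i with rfl | h0
    · simp [hA, hF0, hδ0]
    rcases lt_or_ge i R with h | h
    · have e : F i = P.real {ω | M k ω ≤ y i} := by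
        simp only [hF]
        rw [if_neg (by omega), if_pos h, hνS _ measurableSet_Iic, ← hlaw k _ measurableSet_Iic]
        rfl
      rw [hAN k i h0 h, e]
      have h1 : P.real {ω | M k ω ≤ y i} ≤ P.real (N k (y i))ᶜ := by
        refine ENNReal.toReal_mono (measure_ne_top _ _) (measure_mono_ae ?_)
        filter_upwards [hNae k] with ω hω h2
        exact fun h3 => absurd ((hω (y i)).1 h3) (not_lt.2 h2)
      have h2 : P.real (N k (y i))ᶜ ≤ P.real ({ω | M k ω ≤ y i} ∪ {ω | M k ω = 0}) := by
        refine ENNReal.toReal_mono (measure_ne_top _ _) (measure_mono_ae ?_)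
        filter_upwards [hNae k] with ω hω h2
        rcases le_or_gt (M k ω) (y i) with h3 | h3
        · exact Or.inl h3
        · exact Or.inr (((hω (y i)).2 h3).resolve_left h2)
      have h3 := measureReal_union_le (μ := P) {ω | M k ω ≤ y i} {ω | M k ω = 0}
      have h4 := hatom k 0
      rw [abs_le]
      constructor <;> linarith
    · rw [hAR k i h, hFR i h]
      simp [hδ0]
  have hB : P.real (⋃ k ∈ Finset.range n, {ω | M k ω = 0}) ≤ n * δ := by
    refine (measureReal_biUnion_finset_le _ _).trans ?_
    refine (Finset.sum_le_sum fun k _ => hatom k 0).trans ?_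
    simp
  have main := measureReal_le_of_nearly_independent (P := P) hj (A := A) (F := F) (R := R)
    (η := 2 / R) (E := {ω | ∀ k < n, M k ω ≤ M j ω})
    (B := ⋃ k ∈ Finset.range n, {ω | M k ω = 0})
    (ε := n * mixingCoeff P (tailSigma X φ (Iic 0)) (tailSigma X φ (Ici s)) + n * δ)
    (by positivity) (fun k i => tailSigma_le hX.measurable φ _ _ (hAmeas k i)) hAmono hFmono hF0 hF1
    hFjump ?_ ?_
  · linarith
  · intro f
    have h1 := hX.stationary.abs_measureReal_iInter_sub_prod_le hsep (fun k => hAmeas k (f k)) n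
    have h2 := abs_prod_sub_prod_le (n := n) (x := fun k => P.real (A k (f k)))
      (y := fun k => F (f k)) (ε := δ) (fun k _ => ⟨measureReal_nonneg, measureReal_le_one⟩)
      (fun k _ => ⟨hF0 ▸ hFmono (Nat.zero_le _), hF1 _⟩) (fun k _ => hAF k (f k))
    exact (abs_sub_le _ _ _).trans (add_le_add h1 h2)
  · filter_upwards [ae_all_iff.2 hNae] with ω hω hE hBω
    have h0 : ∀ k < n, M k ω ≠ 0 := fun k hk h =>
      hBω (mem_iUnion₂.2 ⟨k, Finset.mem_range.2 hk, h⟩)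
    have hiff : ∀ k < n, ∀ i, 0 < i → i < R → (ω ∈ A k i ↔ M k ω ≤ y i) := by
      intro k hk i h1 h2
      rw [hAN k i h1 h2]
      constructor
      · intro h3
        by_contra h4
        exact (((hω k (y i)).2 (not_le.1 h4)).resolve_right (h0 k hk)) |> h3
      · intro h3 h4
        exact absurd ((hω k (y i)).1 h4) (not_lt.2 h3)
    classical
    have hex : ∃ i, ω ∈ A j i := ⟨R, by rw [hAR j R le_rfl]; trivial⟩
    -- The first level above maximum `j` has index `i + 1`: index `0` is excluded because `A j 0` is
    -- empty.
    obtain ⟨i, hi⟩ : ∃ i, Nat.find hex = i + 1 := by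
      refine Nat.exists_eq_succ_of_ne_zero fun h => ?_
      have := Nat.find_spec hex
      rw [h] at this
      simp [hA] at this
    have hmem := Nat.find_spec hex
    rw [hi] at hmem
    have hnot : ω ∉ A j i := Nat.find_min hex (by omega)
    have hiR : i < R := by
      by_contra h
      exact hnot (by rw [hAR j i (not_lt.1 h)]; trivial)
    refine ⟨i, hiR, hnot, fun k hk => ?_⟩
    rcases lt_or_ge (i + 1) R with h | h
    · rw [hiff k hk _ (by omega) h]
      exact (hE k hk).trans ((hiff j hj _ (by omega) h).1 hmem)
    · rw [hAR k _ h]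
      trivial

end IsRegularStationary

lemma AssumptionA.eventually_measureReal_le (hA : AssumptionA X P) [IsProbabilityMeasure P] {η : ℝ} (hη : 0 < η) :
    ∀ᶠ T in atTop, ∀ x, P.real {ω | pathSup (fun s => X s ω) 0 T = x} ≤ η := by
  filter_upwards [hA.eventually (eventually_lt_nhds hη)] with T hT x
  refine le_trans ?_ hT.le
  refine le_ciSup (f := fun x : ℝ => P.real {ω | pathSup (fun s => X s ω) 0 T = x}) ?_ x
  exact ⟨1, by rintro _ ⟨x, rfl⟩; exact measureReal_le_one⟩

/-- Each of `n` blocks of length `m s` separated by gaps of length `s` carries the largest of the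
block maxima with asymptotic probability at most `1 / n`. -/
theorem IsRegularStationary.eventually_measureReal_forall_pathSup_le
    (hX : IsRegularStationary X P) [IsProbabilityMeasure P] (hmix : TailSM X P)
    (hA : AssumptionA X P) {m n : ℕ} (hm : 0 < m) {η : ℝ} (hη : 0 < η) :
    ∀ᶠ s in atTop, ∀ c : ℝ, ∀ j < n,
      P.real {ω | ∀ k < n,
        pathSup (fun t => X t ω) (c + k * ((m + 1) * s)) (c + k * ((m + 1) * s) + m * s) ≤
        pathSup (fun t => X t ω) (c + j * ((m + 1) * s)) (c + j * ((m + 1) * s) + m * s)} ≤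
      1 / n + η := by
  obtain ⟨φ, hφ, hα⟩ := hmix
  obtain ⟨R, hR⟩ := exists_nat_gt (max 1 (n * 2 / (η / 3)))
  have hR1 : (1 : ℝ) < R := (le_max_left _ _).trans_lt hR
  have hR0 : (0 : ℝ) < R := by linarith
  have hRn : n * (2 / R) ≤ η / 3 := by
    have := ((le_max_right _ _).trans_lt hR).le
    rw [div_le_iff₀ (by positivity)] at this
    rw [← mul_div_assoc, div_le_iff₀ hR0]
    linarith
  obtain ⟨δ, hδ0, hδR, hδη⟩ : ∃ δ : ℝ, 0 < δ ∧ δ < 1 / (2 * R) ∧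
      2 * R * (n * δ + n * δ) + n * δ ≤ η * (2 / 3) := by
    have hc : 0 < 4 * R * n + n + (1 : ℝ) := by positivity
    refine ⟨min (1 / (4 * R)) (η * (2 / 3) / (4 * R * n + n + 1)), by positivity, ?_, ?_⟩
    · refine (min_le_left _ _).trans_lt ?_
      exact one_div_lt_one_div_of_lt (by positivity) (by linarith)
    · have h1 := min_le_right (1 / (4 * (R : ℝ))) (η * (2 / 3) / (4 * R * n + n + 1))
      rw [le_div_iff₀ hc] at h1
      have h2 : 0 ≤ min (1 / (4 * (R : ℝ))) (η * (2 / 3) / (4 * R * n + n + 1)) := by positivity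
      nlinarith
  have e2 : 1 / (R : ℝ) = 1 / (2 * R) + 1 / (2 * R) := by field_simp; norm_num
  have hm1 : (1 : ℝ) ≤ m := by exact_mod_cast hm
  have hms : Tendsto (fun s : ℝ => m * s) atTop atTop := tendsto_id.const_mul_atTop (by linarith)
  filter_upwards [hms.eventually (hA.eventually_measureReal_le hδ0), hα.eventually (eventually_lt_nhds hδ0),
    hφ.eventually (eventually_gt_nhds (show 1 - 1 / (2 * (R : ℝ)) < 1 by
      have : 0 < 1 / (2 * (R : ℝ)) := by positivity
      linarith)), eventually_gt_atTop 0] with s h1 h2 h3 h4 c j hj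
  have hs : s ≤ m * s := by nlinarith
  have h5 : P.real {ω | pathSup (fun t => X t ω) 0 (m * s) ≤ φ s} < 1 / R := by
    -- TailSM controls only the strict inequality `< φ s`; equality is an atom, small by Assumption
    -- A. Each part contributes less than `1 / (2 * R)`.
    have hsub : {ω | pathSup (fun t => X t ω) 0 (m * s) ≤ φ s} ⊆
        {ω | φ s ≤ pathSup (fun t => X t ω) 0 s}ᶜ ∪
          {ω | pathSup (fun t => X t ω) 0 (m * s) = φ s} := by
      intro ω hω
      rw [mem_ofPred_eq] at hω
      rcases hω.lt_or_eq with h | h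
      · refine Or.inl fun h' => absurd (h'.trans ?_) (not_le.2 h)
        exact pathSup_mono (hX.usc ω) le_rfl h4.le hs
      · exact Or.inr h
    have hnm : NullMeasurableSet {ω | φ s ≤ pathSup (fun t => X t ω) 0 s} P :=
      nullMeasurableSet_le aemeasurable_const (hX.aemeasurable_pathSup h4.le)
    have h6 := (measureReal_mono hsub).trans (measureReal_union_le (μ := P) _ _)
    rw [probReal_compl_eq_one_sub₀ hnm] at h6
    linarith [h1 (φ s)]
  have hsep : ∀ i k : ℕ, i < k → c + i * ((m + 1) * s) + m * s + s ≤ c + k * ((m + 1) * s) := by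
    intro i k hik
    have h6 : (i : ℝ) + 1 ≤ k := by exact_mod_cast hik
    have h7 : 0 ≤ (m + 1) * s := by positivity
    nlinarith
  have main := hX.measureReal_forall_pathSup_le (a := fun k => c + k * ((m + 1) * s))
    (b := fun k => c + k * ((m + 1) * s) + m * s) (φ := φ s) hj (by exact_mod_cast hR0) hsep
    (by positivity) (fun _ => rfl) h1 (by linarith) h5
  refine main.trans ?_
  have h8 : 2 * R * (n * mixingCoeff P (tailSigma X (φ s) (Iic 0)) (tailSigma X (φ s) (Ici s)) +
      n * δ) ≤ 2 * R * (n * δ + n * δ) := by gcongr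
  linarith

end SupLocation

namespace SupLocation

/-! ### Asymptotic uniformity of the supremum location over macroscopic blocks -/

variable {Ω : Type*} [MeasurableSpace Ω] {X : ℝ → Ω → ℝ} {P : Measure Ω}

/-- The upper bounds on blocks and gaps yield the lower bound by complementation. The case `j = 0`
is left out of the latter because no gap precedes the left end point `0`. -/
theorem IsRegularStationary.exists_eventually_block
    (hX : IsRegularStationary X P) [IsProbabilityMeasure P] (hmix : TailSM X P)
    (hA : AssumptionA X P) {n : ℕ} (hn : 0 < n) (m₀ : ℕ) {η : ℝ} (hη : 0 < η) :
    ∃ m ≥ m₀, 0 < m ∧ ∀ᶠ s in atTop,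
      (∀ j < n, P.real {ω | leftmostSupLoc (fun t => X t ω) 0 ((n * (m + 1) - 1) * s) ∈
        Icc ((j : ℝ) * ((m + 1) * s)) (j * ((m + 1) * s) + m * s)} ≤ 1 / n + η) ∧
      ∀ j < n, 0 < j → 1 / n - η ≤
        P.real {ω | leftmostSupLoc (fun t => X t ω) 0 ((n * (m + 1) - 1) * s) ∈
          Ioc ((j : ℝ) * ((m + 1) * s)) (j * ((m + 1) * s) + m * s)} := by
  have hn0 : (0 : ℝ) < n := by exact_mod_cast hn
  have hn1 : (1 : ℝ) ≤ n := by exact_mod_cast hn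
  set δ := η / (3 * n) with hδ
  have hδ0 : 0 < δ := by positivity
  have hδn : n * δ = η / 3 := by rw [hδ]; field_simp
  have hδη : δ ≤ η := by nlinarith
  obtain ⟨N', hN'⟩ := exists_nat_gt (1 / δ)
  set N := max N' (max m₀ 1) with hN
  have hNpos : 0 < N := lt_of_lt_of_le one_pos ((le_max_right m₀ 1).trans (le_max_right _ _))
  have hNm : m₀ ≤ N := (le_max_left m₀ 1).trans (le_max_right _ _)
  have hN0 : (0 : ℝ) < N := by exact_mod_cast hNpos
  have hNδ : 1 / (N : ℝ) ≤ δ := by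
    have h1 : (N' : ℝ) ≤ N := by exact_mod_cast le_max_left _ _
    rw [div_le_iff₀ hN0]
    rw [div_lt_iff₀ hδ0] at hN'
    nlinarith
  clear_value N δ
  -- With `m = 2 * N`, a gap and the block after it have room for `N` intervals of length `s` at
  -- spacing `s`, the gap being the first of them.
  refine ⟨2 * N, by omega, by omega, ?_⟩
  obtain ⟨m, hm⟩ : ∃ m, m = 2 * N := ⟨_, rfl⟩
  rw [← hm]
  have hmN : (m : ℝ) = 2 * N := by exact_mod_cast hm
  filter_upwards [hX.eventually_measureReal_forall_pathSup_le hmix hA (m := m) (n := n)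
      (by omega) hδ0, hX.eventually_measureReal_forall_pathSup_le hmix hA (m := 1) (n := N)
      one_pos hδ0, eventually_gt_atTop 0] with s h1 h2 hs
  set ℓ : ℝ := (m + 1) * s with hℓ
  set W : ℝ := (n * (m + 1) - 1) * s with hW
  have hℓ0 : 0 < ℓ := by positivity
  have hms : ℓ = m * s + s := by rw [hℓ]; ring
  have hms0 : 0 ≤ m * s := by positivity
  have hWℓ : W = n * ℓ - s := by rw [hW, hℓ]; ring
  have hW0 : 0 ≤ W := by nlinarith
  have hblock : ∀ k : ℕ, k < n → k * ℓ + m * s ≤ W := by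
    intro k hk
    have : (k : ℝ) + 1 ≤ n := by exact_mod_cast hk
    nlinarith
  have hup : ∀ j < n, P.real {ω | leftmostSupLoc (fun t => X t ω) 0 W ∈
      Icc ((j : ℝ) * ℓ) (j * ℓ + m * s)} ≤ 1 / n + δ := by
    intro j hj
    refine le_trans (measureReal_mono ?_) (h1 0 j hj)
    intro ω hω k hk
    have hω' : leftmostSupLoc (fun t => X t ω) 0 W ∈ Icc (0 + j * ℓ) (0 + j * ℓ + m * s) := by
      rw [zero_add]; exact hω
    refine pathSup_le_of_leftmostSupLoc_mem (hX.usc ω) ?_ (by linarith) ?_ hW0 hω'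
    · positivity
    · rw [zero_add]
      exact hblock k hk
  have hgap : ∀ k < n - 1, P.real {ω | leftmostSupLoc (fun t => X t ω) 0 W ∈
      Icc ((k : ℝ) * ℓ + m * s) ((k + 1) * ℓ)} ≤ 1 / N + δ := by
    intro k hk
    refine le_trans (measureReal_mono ?_) (h2 (k * ℓ + m * s) 0 hNpos)
    intro ω hω i hi
    have e : k * ℓ + m * s + (0 : ℕ) * (((1 : ℕ) + 1) * s) + (1 : ℕ) * s = (k + 1) * ℓ := by
      rw [hℓ]; push_cast; ring
    have e' : k * ℓ + m * s + (0 : ℕ) * (((1 : ℕ) + 1) * s) = k * ℓ + m * s := by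
      push_cast; ring
    rw [e, e']
    refine pathSup_le_of_leftmostSupLoc_mem (hX.usc ω) ?_ ?_ ?_ hW0 hω
    · positivity
    · simpa using hs.le
    · refine le_trans ?_ (hblock (k + 1) (by omega))
      have h3 : (i : ℝ) + 1 ≤ N := by exact_mod_cast hi
      have h4 : ((i : ℝ) + 1) * s ≤ N * s := by gcongr
      rw [hms, hmN]
      push_cast
      nlinarith
  refine ⟨fun j hj => (hup j hj).trans (by linarith), fun j hj hj0 => ?_⟩
  set τ : Ω → ℝ := fun ω => leftmostSupLoc (fun t => X t ω) 0 W with hτ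
  have hcover : (univ : Set Ω) ⊆ {ω | τ ω ∈ Ioc ((j : ℝ) * ℓ) (j * ℓ + m * s)} ∪
      ((⋃ k ∈ (Finset.range n).erase j, {ω | τ ω ∈ Icc ((k : ℝ) * ℓ) (k * ℓ + m * s)}) ∪
      ⋃ k ∈ Finset.range (n - 1), {ω | τ ω ∈ Icc ((k : ℝ) * ℓ + m * s) ((k + 1) * ℓ)}) := by
    intro ω _
    obtain ⟨⟨hτ0, hτW⟩, -⟩ := leftmostSupLoc_mem (hX.usc ω) hW0
    change 0 ≤ τ ω at hτ0
    change τ ω ≤ W at hτW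
    set k := ⌊τ ω / ℓ⌋₊ with hk
    have hk1 : k * ℓ ≤ τ ω := (le_div_iff₀ hℓ0).1 (Nat.floor_le (div_nonneg hτ0 hℓ0.le))
    have hk2 : τ ω < (k + 1) * ℓ := (div_lt_iff₀ hℓ0).1 (Nat.lt_floor_add_one _)
    have hkn : k < n := by
      by_contra h
      have : (n : ℝ) ≤ k := by exact_mod_cast not_lt.1 h
      nlinarith
    rcases le_or_gt (τ ω) (k * ℓ + m * s) with h3 | h3
    · by_cases hkj : k = j
      · rcases hk1.lt_or_eq with h4 | h4
        · exact Or.inl ⟨hkj ▸ h4, hkj ▸ h3⟩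
        -- The point `j * ℓ` is missing from the half-open block but is the right end of the
        -- preceding closed gap.
        · refine Or.inr (Or.inr (mem_iUnion₂.2 ⟨j - 1, Finset.mem_range.2 (by omega), ?_⟩))
          have e : ((j - 1 : ℕ) : ℝ) + 1 = j := by
            rw [Nat.cast_sub hj0]; simp
          have e' : ((j - 1 : ℕ) : ℝ) * ℓ = j * ℓ - ℓ := by rw [← e]; ring
          rw [hkj] at h4
          rw [mem_ofPred_eq, e, e']
          exact ⟨by linarith, h4.ge⟩
      · exact Or.inr (Or.inl (mem_iUnion₂.2 ⟨k, by simp [hkj, hkn], hk1, h3⟩))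
    · refine Or.inr (Or.inr (mem_iUnion₂.2 ⟨k, Finset.mem_range.2 ?_, h3.le, hk2.le⟩))
      by_contra h
      have : (n : ℝ) ≤ k + 1 := by exact_mod_cast (by omega : n ≤ k + 1)
      nlinarith
  have h3 := (measureReal_mono (μ := P) hcover).trans (measureReal_union_le _ _)
  have h4 := measureReal_union_le (μ := P)
    (⋃ k ∈ (Finset.range n).erase j, {ω | τ ω ∈ Icc ((k : ℝ) * ℓ) (k * ℓ + m * s)})
    (⋃ k ∈ Finset.range (n - 1), {ω | τ ω ∈ Icc ((k : ℝ) * ℓ + m * s) ((k + 1) * ℓ)})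
  have h5 : P.real (⋃ k ∈ (Finset.range n).erase j, {ω | τ ω ∈ Icc ((k : ℝ) * ℓ) (k * ℓ + m * s)}) ≤
      (n - 1) * (1 / n + δ) := by
    refine (measureReal_biUnion_finset_le _ _).trans ((Finset.sum_le_sum fun k hk =>
      hup k (Finset.mem_range.1 (Finset.mem_of_mem_erase hk))).trans ?_)
    rw [Finset.sum_const, Finset.card_erase_of_mem (Finset.mem_range.2 hj), Finset.card_range,
      nsmul_eq_mul, Nat.cast_sub hn, Nat.cast_one]
  have h6 : P.real (⋃ k ∈ Finset.range (n - 1), {ω | τ ω ∈ Icc ((k : ℝ) * ℓ + m * s) ((k + 1) * ℓ)}) ≤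
      (n - 1) * (1 / N + δ) := by
    refine (measureReal_biUnion_finset_le _ _).trans ((Finset.sum_le_sum fun k hk =>
      hgap k (Finset.mem_range.1 hk)).trans ?_)
    rw [Finset.sum_const, Finset.card_range, nsmul_eq_mul, Nat.cast_sub hn, Nat.cast_one]
  rw [probReal_univ] at h3
  have h7 : ((n : ℝ) - 1) * (1 / n + δ) ≤ 1 - 1 / n + n * δ := by
    have : (n : ℝ) * (1 / n) = 1 := by field_simp
    nlinarith
  have h8 : ((n : ℝ) - 1) * (1 / N + δ) ≤ 2 * (n * δ) := by nlinarith
  change 1 / n - η ≤ P.real {ω | τ ω ∈ Ioc ((j : ℝ) * ℓ) (j * ℓ + m * s)}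
  linarith

end SupLocation

namespace SupLocation

/-! ### From macroscopic blocks to intervals of arbitrary length -/

/-- Cut `[u, u + d]` into `N + 1` equal pieces, add the local bounds, and let `N → ∞`. -/
lemma sub_le_of_eventually_local {G ψ : ℝ → ℝ} {u d c : ℝ} (hd : 0 < d)
    (hψ : Tendsto ψ (𝓝[>] 0) (𝓝 c))
    (h : ∀ᶠ e in 𝓝[>] 0, ∀ w, u ≤ w → w + e ≤ u + d → G (w + e) - G w ≤ e * ψ e) :
    G (u + d) - G u ≤ d * c := by
  have hN : Tendsto (fun N : ℕ => d / ((N : ℝ) + 1)) atTop (𝓝[>] 0) := by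
    refine tendsto_nhdsWithin_iff.2 ⟨?_, Eventually.of_forall fun N => ?_⟩
    · exact tendsto_const_nhds.div_atTop
        (tendsto_atTop_add_const_right _ _ tendsto_natCast_atTop_atTop)
    · exact div_pos hd (by positivity)
  refine ge_of_tendsto ((hψ.comp hN).const_mul d) ?_
  filter_upwards [hN.eventually h] with N hNe
  set e := d / ((N : ℝ) + 1) with he
  have he0 : 0 < e := div_pos hd (by positivity)
  have hed : ((N + 1 : ℕ) : ℝ) * e = d := by
    push_cast
    rw [he]; field_simp
  have hsum := Finset.sum_range_sub (fun i : ℕ => G (u + i * e)) (N + 1)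
  rw [hed] at hsum
  simp only [Nat.cast_zero, zero_mul, add_zero] at hsum
  rw [← hsum]
  calc _ ≤ ∑ i ∈ Finset.range (N + 1), e * ψ e := by
        refine Finset.sum_le_sum fun i hi => ?_
        have h1 : ((i : ℝ) + 1) ≤ (N + 1 : ℕ) := by exact_mod_cast Finset.mem_range.1 hi
        have h2 : ((i : ℝ) + 1) * e ≤ (N + 1 : ℕ) * e := by gcongr
        have h3 := hNe (u + i * e) (by simp; positivity) (by rw [← hed]; linarith)
        have h4 : u + (i + 1 : ℕ) * e = u + i * e + e := by push_cast; ring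
        rw [h4]
        exact h3
    _ = d * ψ e := by
        rw [Finset.sum_const, Finset.card_range, nsmul_eq_mul, ← mul_assoc, hed]

variable {Ω : Type*} [MeasurableSpace Ω] {X : ℝ → Ω → ℝ} {P : Measure Ω}

namespace IsRegularStationary

/-- `⌊r / e⌋` disjoint translates of `(w, w + e]` fit into the block `(p, p + r]`. Each of them has
at least as much mass in the window `[0, W]`, which leaves less room on both sides. -/
lemma measureReal_mul_le_block (hX : IsRegularStationary X P) [IsFiniteMeasure P]
    {T W p r w e : ℝ} (he : 0 < e) (hp : 0 ≤ p) (hr : 0 ≤ r) (hpW : p + r ≤ W) (hpw : p + r ≤ w)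
    (hW : W - p ≤ T - w) :
    P.real {ω | leftmostSupLoc (fun t => X t ω) 0 T ∈ Ioc w (w + e)} * (r - e) ≤
      e * P.real {ω | leftmostSupLoc (fun t => X t ω) 0 W ∈ Ioc p (p + r)} := by
  set q := P.real {ω | leftmostSupLoc (fun t => X t ω) 0 T ∈ Ioc w (w + e)}
  have hq : 0 ≤ q := measureReal_nonneg
  set G : ℝ → ℝ := fun x => P.real {ω | leftmostSupLoc (fun t => X t ω) 0 W ≤ x} with hG
  have hGmono : Monotone G := fun x y hxy => measureReal_mono fun ω hω => le_trans hω hxy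
  have hW0 : 0 ≤ W := by linarith
  have hGsub : ∀ x y, x ≤ y →
      P.real {ω | leftmostSupLoc (fun t => X t ω) 0 W ∈ Ioc x y} = G y - G x :=
    fun x y hxy => hX.measureReal_leftmostSupLoc_Ioc_eq_sub hW0 hxy
  set K := ⌊r / e⌋₊
  have hK1 : K * e ≤ r := (le_div_iff₀ he).1 (Nat.floor_le (div_nonneg hr he.le))
  have hK2 : r < (K + 1) * e := (div_lt_iff₀ he).1 (Nat.lt_floor_add_one _)
  have hsum := Finset.sum_range_sub (fun i : ℕ => G (p + i * e)) K
  simp only [Nat.cast_zero, zero_mul, add_zero] at hsum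
  have hterm : ∀ i ∈ Finset.range K, q ≤ G (p + (i + 1 : ℕ) * e) - G (p + i * e) := by
    intro i hi
    have h1 : ((i : ℝ) + 1) ≤ K := by exact_mod_cast Finset.mem_range.1 hi
    have h2 : ((i : ℝ) + 1) * e ≤ K * e := by gcongr
    have h0 : 0 ≤ (i : ℝ) * e := by positivity
    have e1 : p + (i + 1 : ℕ) * e = p + i * e + e := by push_cast; ring
    rw [e1, ← hGsub _ _ (by linarith)]
    exact hX.measureReal_leftmostSupLoc_le_of_window he.le (by linarith) (by linarith)
      (by linarith) (by linarith)
  have h3 := Finset.sum_le_sum hterm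
  rw [hsum, Finset.sum_const, Finset.card_range, nsmul_eq_mul] at h3
  rw [hGsub _ _ (by linarith)]
  have h4 : G (p + K * e) ≤ G (p + r) := hGmono (by linarith)
  calc q * (r - e) ≤ q * (K * e) := mul_le_mul_of_nonneg_left (by linarith) hq
    _ = e * (K * q) := by ring
    _ ≤ e * (G (p + r) - G p) := mul_le_mul_of_nonneg_left (by linarith) he.le

/-- The reverse comparison: `⌈r / e⌉` translates cover the block, and `[0, W]` now leaves more room
on both sides. -/
lemma block_le_measureReal_mul (hX : IsRegularStationary X P) [IsFiniteMeasure P]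
    {T W p r w e : ℝ} (he : 0 < e) (hw : 0 ≤ w) (hr : 0 ≤ r) (hwT : w + e ≤ T) (hwp : w ≤ p)
    (hW : T - w ≤ W - (p + r)) :
    e * P.real {ω | leftmostSupLoc (fun t => X t ω) 0 W ∈ Ioc p (p + r)} ≤
      P.real {ω | leftmostSupLoc (fun t => X t ω) 0 T ∈ Ioc w (w + e)} * (r + e) := by
  set q := P.real {ω | leftmostSupLoc (fun t => X t ω) 0 T ∈ Ioc w (w + e)}
  have hq : 0 ≤ q := measureReal_nonneg
  set G : ℝ → ℝ := fun x => P.real {ω | leftmostSupLoc (fun t => X t ω) 0 W ≤ x} with hG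
  have hGmono : Monotone G := fun x y hxy => measureReal_mono fun ω hω => le_trans hω hxy
  have hW0 : 0 ≤ W := by linarith
  have hGsub : ∀ x y, x ≤ y →
      P.real {ω | leftmostSupLoc (fun t => X t ω) 0 W ∈ Ioc x y} = G y - G x :=
    fun x y hxy => hX.measureReal_leftmostSupLoc_Ioc_eq_sub hW0 hxy
  set K := ⌈r / e⌉₊
  have hK1 : r ≤ K * e := (div_le_iff₀ he).1 (Nat.le_ceil _)
  have hK2 : K * e < r + e := by
    have := Nat.ceil_lt_add_one (div_nonneg hr he.le)
    calc K * e < (r / e + 1) * e := by gcongr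
      _ = r + e := by field_simp
  have hsum := Finset.sum_range_sub (fun i : ℕ => G (p + i * e)) K
  simp only [Nat.cast_zero, zero_mul, add_zero] at hsum
  have hterm : ∀ i ∈ Finset.range K, G (p + (i + 1 : ℕ) * e) - G (p + i * e) ≤ q := by
    intro i hi
    have h1 : ((i : ℝ) + 1) ≤ K := by exact_mod_cast Finset.mem_range.1 hi
    have h2 : ((i : ℝ) + 1) * e ≤ K * e := by gcongr
    have h0 : 0 ≤ (i : ℝ) * e := by positivity
    have e1 : p + (i + 1 : ℕ) * e = p + i * e + e := by push_cast; ring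
    rw [e1, ← hGsub _ _ (by linarith)]
    exact hX.measureReal_leftmostSupLoc_le_of_window he.le (by linarith) (by linarith)
      (by linarith) (by linarith)
  have h3 := Finset.sum_le_sum hterm
  rw [hsum, Finset.sum_const, Finset.card_range, nsmul_eq_mul] at h3
  rw [hGsub _ _ (by linarith)]
  have h4 : G (p + r) ≤ G (p + K * e) := hGmono (by linarith)
  calc e * (G (p + r) - G p) ≤ e * (K * q) := mul_le_mul_of_nonneg_left (by linarith) he.le
    _ = q * (K * e) := by ring
    _ ≤ q * (r + e) := mul_le_mul_of_nonneg_left (by linarith) hq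

theorem eventually_measureReal_Ioc_le (hX : IsRegularStationary X P) [IsProbabilityMeasure P]
    (hmix : TailSM X P) (hA : AssumptionA X P) {ε δ : ℝ} (hε : 0 < ε) (hδ : 0 < δ) (hδ1 : δ ≤ 1) :
    ∀ᶠ T in atTop, ∀ u d, ε * T ≤ u → 0 < d → u + d ≤ (1 - ε) * T →
      P.real {ω | leftmostSupLoc (fun t => X t ω) 0 T ∈ Ioc u (u + d)} ≤ d * ((1 + δ) / T) := by
  obtain ⟨n, hn⟩ := exists_nat_gt (max (1 / ε) (16 / δ))
  have hn1 : 1 / ε < n := (le_max_left _ _).trans_lt hn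
  have hn2 : 16 / δ < n := (le_max_right _ _).trans_lt hn
  have hn0 : (0 : ℝ) < n := (by positivity : 0 < 1 / ε).trans hn1
  rw [div_lt_iff₀ hε] at hn1
  rw [div_lt_iff₀ hδ] at hn2
  obtain ⟨m₀, hm₀⟩ := exists_nat_gt (8 / δ)
  obtain ⟨m, hm, hm0, hev⟩ := hX.exists_eventually_block hmix hA (n := n)
    (by exact_mod_cast hn0) m₀ (η := δ / (8 * n)) (by positivity)
  have hm0' : (0 : ℝ) < m := by exact_mod_cast hm0
  have hm2 : 8 < m * δ := by
    rw [div_lt_iff₀ hδ] at hm₀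
    have : (m₀ : ℝ) ≤ m := by exact_mod_cast hm
    nlinarith
  have hc : (0 : ℝ) < (n + 2) * (m + 1) := by positivity
  have hlim : Tendsto (fun T : ℝ => T / ((n + 2) * (m + 1))) atTop atTop :=
    tendsto_id.atTop_div_const hc
  filter_upwards [hlim.eventually hev, eventually_gt_atTop 0] with T hT hT0 u d hu hd hud
  -- This makes `T = (n + 2) * ℓ`, so `[0, W]` is almost two periods shorter than needed to match
  -- `T`. An interval starting in period `k` can then be compared with block `k - 1`, with room on
  -- both sides. The choice `n > 1 / ε` gives `ℓ ≤ ε * T`, hence `1 ≤ k ≤ n`.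
  set s : ℝ := T / ((n + 2) * (m + 1)) with hs
  obtain ⟨hT, -⟩ := hT
  have hs0 : 0 < s := div_pos hT0 hc
  set ℓ : ℝ := (m + 1) * s with hℓ
  have hℓ0 : 0 < ℓ := by positivity
  have hTℓ : T = (n + 2) * ℓ := by rw [hℓ, hs]; field_simp
  have hℓε : ℓ ≤ ε * T := by
    rw [hTℓ]
    nlinarith
  set W : ℝ := (n * (m + 1) - 1) * s with hW
  have hWℓ : W = n * ℓ - s := by rw [hW, hℓ]; ring
  have hms : m * s = ℓ - s := by rw [hℓ]; ring
  have hms0 : 0 < m * s := by positivity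
  set c : ℝ := 1 / n + δ / (8 * n) with hcdef
  have hc0 : 0 < c := by positivity
  have hψ : Tendsto (fun e => c / (m * s - e)) (𝓝[>] 0) (𝓝 (c / (m * s - 0))) := by
    refine Tendsto.mono_left ?_ nhdsWithin_le_nhds
    exact tendsto_const_nhds.div (tendsto_const_nhds.sub tendsto_id) (by simpa using hms0.ne')
  have hfin := sub_le_of_eventually_local
    (G := fun x => P.real {ω | leftmostSupLoc (fun t => X t ω) 0 T ≤ x}) (u := u) hd hψ ?_
  · rw [hX.measureReal_leftmostSupLoc_Ioc_eq_sub hT0.le (by linarith)]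
    refine hfin.trans (mul_le_mul_of_nonneg_left ?_ hd.le)
    rw [sub_zero, div_le_div_iff₀ hms0 hT0, hcdef, hTℓ, hℓ]
    have e1 : (1 / (n : ℝ) + δ / (8 * n)) * ((n + 2) * ((m + 1) * s)) =
      ((1 + δ / 8) * ((n + 2) / n) * ((m + 1) / m)) * (m * s) := by field_simp
    rw [e1]
    refine mul_le_mul_of_nonneg_right ?_ hms0.le
    have h1 : ((n : ℝ) + 2) / n ≤ 1 + δ / 8 := by
      rw [div_le_iff₀ hn0]; nlinarith
    have h2 : ((m : ℝ) + 1) / m ≤ 1 + δ / 8 := by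
      rw [div_le_iff₀ hm0']; nlinarith
    calc _ ≤ (1 + δ / 8) * (1 + δ / 8) * (1 + δ / 8) := by gcongr
      _ ≤ 1 + δ := by
        have h3 : δ * δ ≤ δ := mul_le_of_le_one_left hδ.le hδ1
        have h4 : δ * (δ * δ) ≤ δ := (mul_le_of_le_one_left (by positivity) hδ1).trans h3
        linarith
  · filter_upwards [Ioo_mem_nhdsGT hms0] with e he w huw hwd
    rw [← hX.measureReal_leftmostSupLoc_Ioc_eq_sub hT0.le (by linarith [he.1])]
    have hw0 : 0 ≤ w := by nlinarith
    set k := ⌊w / ℓ⌋₊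
    have hk1 : k * ℓ ≤ w := (le_div_iff₀ hℓ0).1 (Nat.floor_le (div_nonneg hw0 hℓ0.le))
    have hk2 : w < (k + 1) * ℓ := (div_lt_iff₀ hℓ0).1 (Nat.lt_floor_add_one _)
    have hkpos : 0 < k := by
      by_contra h
      have : k = 0 := by omega
      rw [this] at hk2
      simp only [Nat.cast_zero, zero_add, one_mul] at hk2
      linarith
    have hkn : k < n + 1 := by
      by_contra h
      have h1 : ((n : ℝ) + 1) ≤ k := by exact_mod_cast not_lt.1 h
      have h2 : ((n : ℝ) + 1) * ℓ ≤ k * ℓ := by gcongr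
      linarith [he.1]
    obtain ⟨j, hj⟩ : ∃ j, k = j + 1 := ⟨k - 1, by omega⟩
    have hjk : (k : ℝ) = j + 1 := by rw [hj]; push_cast; rfl
    have hjn : (j : ℝ) + 1 ≤ n := by exact_mod_cast (by omega : j + 1 ≤ n)
    have hjn' : ((j : ℝ) + 1) * ℓ ≤ n * ℓ := by gcongr
    rw [hjk] at hk1 hk2
    have key := hX.measureReal_mul_le_block (T := T) (W := W) (p := j * ℓ) (r := m * s) (w := w)
      he.1 (by positivity) hms0.le (by linarith) (by linarith) (by linarith)
    have hb : P.real {ω | leftmostSupLoc (fun t => X t ω) 0 W ∈ Ioc ((j : ℝ) * ℓ) (j * ℓ + m * s)}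
        ≤ c := by
      refine le_trans (measureReal_mono ?_) (hT j (by omega))
      exact fun ω hω => Ioc_subset_Icc_self hω
    rw [← mul_div_assoc, le_div_iff₀ (by linarith [he.2])]
    exact key.trans (mul_le_mul_of_nonneg_left hb he.1.le)

theorem eventually_le_measureReal_Ioc (hX : IsRegularStationary X P) [IsProbabilityMeasure P]
    (hmix : TailSM X P) (hA : AssumptionA X P) {δ : ℝ} (hδ : 0 < δ) (hδ1 : δ ≤ 1) :
    ∀ᶠ T in atTop, ∀ u d, 0 ≤ u → 0 < d → u + d ≤ T →
      d * ((1 - δ) / T) ≤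
        P.real {ω | leftmostSupLoc (fun t => X t ω) 0 T ∈ Ioc u (u + d)} := by
  obtain ⟨n, hn⟩ := exists_nat_gt (max 3 (6 / δ))
  have hn1 : (3 : ℝ) < n := (le_max_left _ _).trans_lt hn
  have hn2 : 6 / δ < n := (le_max_right _ _).trans_lt hn
  have hn0 : (0 : ℝ) < n := by linarith
  have hn3 : (0 : ℝ) < n - 3 := by linarith
  rw [div_lt_iff₀ hδ] at hn2
  obtain ⟨m, -, hm0, hev⟩ := hX.exists_eventually_block hmix hA (n := n)
    (by exact_mod_cast hn0) 0 (η := δ / (2 * n)) (by positivity)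
  have hm0' : (0 : ℝ) < m := by exact_mod_cast hm0
  have hc : (0 : ℝ) < (n - 3) * (m + 1) := by positivity
  have hlim : Tendsto (fun T : ℝ => T / ((n - 3) * (m + 1))) atTop atTop :=
    tendsto_id.atTop_div_const hc
  filter_upwards [hlim.eventually hev, eventually_gt_atTop 0] with T hT hT0 u d hu hd hud
  -- Now `T = (n - 3) * ℓ` is shorter than `W`, and period `k` is compared with block `k + 1`. This
  -- index is positive and less than `n` for every starting point in `[0, T)`, so no distance from
  -- the ends is required.
  set s : ℝ := T / ((n - 3) * (m + 1)) with hs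
  obtain ⟨-, hT⟩ := hT
  have hs0 : 0 < s := div_pos hT0 hc
  set ℓ : ℝ := (m + 1) * s with hℓ
  have hℓ0 : 0 < ℓ := by positivity
  have hTℓ : T = (n - 3) * ℓ := by rw [hℓ, hs]; field_simp
  set W : ℝ := (n * (m + 1) - 1) * s with hW
  have hWℓ : W = n * ℓ - s := by rw [hW, hℓ]; ring
  have hms : m * s = ℓ - s := by rw [hℓ]; ring
  have hms0 : 0 < m * s := by positivity
  set c : ℝ := 1 / n - δ / (2 * n) with hcdef
  have hψ : Tendsto (fun e => -(c / (m * s + e))) (𝓝[>] 0) (𝓝 (-(c / (m * s + 0)))) := by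
    refine (Tendsto.mono_left ?_ nhdsWithin_le_nhds).neg
    exact tendsto_const_nhds.div (tendsto_const_nhds.add tendsto_id) (by simpa using hms0.ne')
  have hfin := sub_le_of_eventually_local
    (G := fun x => -P.real {ω | leftmostSupLoc (fun t => X t ω) 0 T ≤ x}) (u := u) hd hψ ?_
  · rw [hX.measureReal_leftmostSupLoc_Ioc_eq_sub hT0.le (by linarith)]
    have hcomp : d * ((1 - δ) / T) ≤ d * (c / (m * s)) := by
      refine mul_le_mul_of_nonneg_left ?_ hd.le
      rw [div_le_div_iff₀ hT0 hms0, hcdef, hTℓ]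
      have e1 : (1 / (n : ℝ) - δ / (2 * n)) * ((n - 3) * ℓ) =
        ((1 - δ / 2) * ((n - 3) / n)) * ℓ := by field_simp
      rw [e1]
      have h1 : 1 - δ / 2 ≤ ((n : ℝ) - 3) / n := by
        rw [le_div_iff₀ hn0]; nlinarith
      have h2 : 1 - δ ≤ (1 - δ / 2) * ((n - 3) / n) := by
        have : 0 ≤ 1 - δ / 2 := by linarith
        nlinarith
      calc (1 - δ) * (m * s) ≤ (1 - δ) * ℓ :=
            mul_le_mul_of_nonneg_left (by linarith) (by linarith)
        _ ≤ _ := mul_le_mul_of_nonneg_right h2 hℓ0.le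
    rw [add_zero] at hfin
    linarith
  · filter_upwards [self_mem_nhdsWithin] with e he w huw hwd
    have he0 : 0 < e := he
    have hw0 : 0 ≤ w := by linarith
    set k := ⌊w / ℓ⌋₊
    have hk1 : k * ℓ ≤ w := (le_div_iff₀ hℓ0).1 (Nat.floor_le (div_nonneg hw0 hℓ0.le))
    have hk2 : w < (k + 1) * ℓ := (div_lt_iff₀ hℓ0).1 (Nat.lt_floor_add_one _)
    have hkn : k + 1 < n := by
      by_contra h
      have h1 : (n : ℝ) ≤ k + 1 := by exact_mod_cast not_lt.1 h
      have h2 : (n : ℝ) * ℓ ≤ (k + 1) * ℓ := by gcongr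
      linarith
    have key := hX.block_le_measureReal_mul (T := T) (W := W) (p := (k + 1 : ℕ) * ℓ) (r := m * s)
      (w := w) he0 hw0 hms0.le (by linarith) (by push_cast; linarith) (by push_cast; linarith)
    have hb := hT (k + 1) hkn (by omega)
    rw [hX.measureReal_leftmostSupLoc_Ioc_eq_sub hT0.le (by linarith)] at key
    have h3 : e * (c / (m * s + e)) ≤ P.real {ω | leftmostSupLoc (fun t => X t ω) 0 T ≤ w + e} -
        P.real {ω | leftmostSupLoc (fun t => X t ω) 0 T ≤ w} := by
      rw [← mul_div_assoc, div_le_iff₀ (by linarith)]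
      exact (mul_le_mul_of_nonneg_left hb he0.le).trans key
    linarith

/-- The leftmost supremum location over `[0, T]` has, uniformly away from the end points of the
window, asymptotically the uniform distribution on all scales. -/
theorem eventually_measureReal_locEvent (hX : IsRegularStationary X P) [IsProbabilityMeasure P]
    (hmix : TailSM X P) (hA : AssumptionA X P) {ε δ : ℝ} (hε : 0 < ε) (hδ : 0 < δ) (hδ1 : δ ≤ 1) :
    ∀ᶠ T in atTop, ∀ u v, ε * T ≤ u → u < v → v ≤ (1 - ε) * T →
      (v - u) * ((1 - δ) / T) ≤ P.real (locEvent X T u v) ∧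
      P.real (locEvent X T u v) ≤ (v - u) * ((1 + δ) / T) := by
  filter_upwards [hX.eventually_measureReal_Ioc_le hmix hA hε hδ hδ1,
    hX.eventually_le_measureReal_Ioc hmix hA hδ hδ1, eventually_gt_atTop 0]
    with T h1 h2 hT u v hu huv hv
  have hu0 : 0 ≤ u := (mul_pos hε hT).le.trans hu
  have hvT : v ≤ T := by nlinarith
  constructor
  · have hlim : Tendsto (fun e : ℝ => (v - u - e) * ((1 - δ) / T)) (𝓝[>] 0)
        (𝓝 ((v - u - 0) * ((1 - δ) / T))) :=
      Tendsto.mono_left ((tendsto_const_nhds.sub tendsto_id).mul_const _) nhdsWithin_le_nhds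
    rw [sub_zero] at hlim
    refine le_of_tendsto hlim ?_
    filter_upwards [Ioo_mem_nhdsGT (sub_pos.2 huv)] with e he
    refine (h2 u (v - u - e) hu0 (by linarith [he.2]) (by linarith [he.1])).trans ?_
    refine measureReal_mono fun ω hω => ?_
    have := hω.2
    exact ⟨hω.1, by linarith [he.1]⟩
  · have := h1 u (v - u) hu (sub_pos.2 huv) (by linarith)
    rw [add_sub_cancel] at this
    refine le_trans (measureReal_mono ?_) this
    exact fun ω hω => Ioo_subset_Ioc_self hω

end IsRegularStationary

/-! ### Conditional probabilities as ratios of interval probabilities -/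

lemma cond_real_of_subset {E F : Set Ω} (hE : NullMeasurableSet E P) (hFE : F ⊆ E) :
    (cond P E).real F = P.real F / P.real E := by
  simp only [Measure.real, ProbabilityTheory.cond, Measure.smul_apply, Measure.restrict_apply₀' hE,
    inter_eq_left.2 hFE, smul_eq_mul, ENNReal.toReal_mul, ENNReal.toReal_inv]
  rw [div_eq_inv_mul]

end SupLocation

theorem corollary4p2 {Ω : Type*} [MeasurableSpace Ω] (P : Measure Ω) [IsProbabilityMeasure P]
    (X : ℝ → Ω → ℝ) (hmeas : ∀ t, Measurable (X t))
    (husc : ∀ ω, UpperSemicontinuous (fun t => X t ω))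
    (hsep : SupLocation.IsSeparableProcess X P)
    (hstat : SupLocation.IsStationary X P)
    (hmix : SupLocation.TailSM X P)
    (hA : SupLocation.AssumptionA X P)
    (a a' b' b : ℝ → ℝ) (θ : ℝ)
    (hord : ∀ᶠ T in atTop, 0 < a T ∧ a T ≤ a' T ∧ a' T < b' T ∧ b' T ≤ b T ∧ b T < T)
    (ha : 0 < liminf (fun T => a T / T) atTop)
    (hb : limsup (fun T => b T / T) atTop < 1)
    (hθ : Tendsto (fun T => (b' T - a' T) / (b T - a T)) atTop (𝓝 θ)) :
    (∀ᶠ T in atTop, 0 < P (SupLocation.locEvent X T (a T) (b T))) ∧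
    Tendsto
      (fun T => (cond P (SupLocation.locEvent X T (a T) (b T))).real
        (SupLocation.locEvent X T (a' T) (b' T)))
      atTop (𝓝 θ) := by
  have hX : SupLocation.IsRegularStationary X P := ⟨hmeas, husc, hsep, hstat⟩
  obtain ⟨ε₁, hε₁, ha'⟩ := exists_between ha
  obtain ⟨ε₂, hb', hε₂⟩ := exists_between hb
  have hbda : IsBoundedUnder (· ≥ ·) atTop (fun T => a T / T) := by
    refine ⟨0, eventually_map.2 ?_⟩
    filter_upwards [hord, eventually_gt_atTop 0] with T h hT
    exact div_nonneg h.1.le hT.le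
  have hbdb : IsBoundedUnder (· ≤ ·) atTop (fun T => b T / T) := by
    refine ⟨1, eventually_map.2 ?_⟩
    filter_upwards [hord, eventually_gt_atTop 0] with T h hT
    exact (div_le_one hT).2 h.2.2.2.2.le
  set ε := min ε₁ (1 - ε₂)
  have hε : 0 < ε := lt_min hε₁ (by linarith)
  have hloc : ∀ δ : ℝ, 0 < δ → δ ≤ 1 → ∀ᶠ T in atTop,
      ((b T - a T) * ((1 - δ) / T) ≤ P.real (SupLocation.locEvent X T (a T) (b T)) ∧
        P.real (SupLocation.locEvent X T (a T) (b T)) ≤ (b T - a T) * ((1 + δ) / T)) ∧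
      ((b' T - a' T) * ((1 - δ) / T) ≤ P.real (SupLocation.locEvent X T (a' T) (b' T)) ∧
        P.real (SupLocation.locEvent X T (a' T) (b' T)) ≤ (b' T - a' T) * ((1 + δ) / T)) := by
    intro δ hδ hδ1
    filter_upwards [hX.eventually_measureReal_locEvent hmix hA hε hδ hδ1, hord,
      eventually_lt_of_lt_liminf ha' hbda, eventually_lt_of_limsup_lt hb' hbdb,
      eventually_gt_atTop 0] with T h1 h2 h3 h4 hT
    rw [lt_div_iff₀ hT] at h3
    rw [div_lt_iff₀ hT] at h4
    have h5 : ε * T ≤ ε₁ * T := mul_le_mul_of_nonneg_right (min_le_left _ _) hT.le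
    have h6 : ε * T ≤ (1 - ε₂) * T := mul_le_mul_of_nonneg_right (min_le_right _ _) hT.le
    exact ⟨h1 _ _ (by linarith) (by linarith) (by linarith),
      h1 _ _ (by linarith) (by linarith) (by linarith)⟩
  constructor
  · filter_upwards [hloc (1 / 2) (by norm_num) (by norm_num), hord, eventually_gt_atTop 0]
      with T h1 h2 hT
    have h3 : 0 < (b T - a T) * ((1 - 1 / 2) / T) :=
      mul_pos (by linarith) (div_pos (by norm_num) hT)
    exact (ENNReal.toReal_pos_iff.1 (h3.trans_le h1.1.1)).1
  · have hdiff : Tendsto (fun T => (cond P (SupLocation.locEvent X T (a T) (b T))).real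
        (SupLocation.locEvent X T (a' T) (b' T)) - (b' T - a' T) / (b T - a T)) atTop (𝓝 0) := by
      rw [Metric.tendsto_nhds]
      intro η hη
      -- The bound `δ ≤ 1 / 2` gives `D ≤ 2 * r`, so the difference of the two ratios is at most `4
      -- * δ`, which is below `η`.
      set δ := min (1 / 2) (η / 8)
      have hδ : 0 < δ := lt_min (by norm_num) (by positivity)
      have hδ2 : δ ≤ 1 / 2 := min_le_left _ _
      have hδη : δ ≤ η / 8 := min_le_right _ _
      filter_upwards [hloc δ hδ (by linarith), hord, eventually_gt_atTop 0] with T h1 h2 hT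
      obtain ⟨⟨hl, hu⟩, hl', hu'⟩ := h1
      obtain ⟨h3, h4, h5, h6, h7⟩ := h2
      have hsub : SupLocation.locEvent X T (a' T) (b' T) ⊆ SupLocation.locEvent X T (a T) (b T) :=
        fun ω hω => ⟨h4.trans_lt hω.1, hω.2.trans_le h6⟩
      have hnull : NullMeasurableSet (SupLocation.locEvent X T (a T) (b T)) P :=
        hX.nullMeasurableSet_leftmostSupLoc hT.le measurableSet_Ioo
      rw [SupLocation.cond_real_of_subset hnull hsub, Real.dist_eq, sub_zero]
      have hD : 0 < b T - a T := by linarith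
      have hD' : 0 < b' T - a' T := by linarith
      have hDD : b' T - a' T ≤ b T - a T := by linarith
      generalize P.real (SupLocation.locEvent X T (a' T) (b' T)) = q' at *
      generalize P.real (SupLocation.locEvent X T (a T) (b T)) = q at *
      generalize b T - a T = D at *
      generalize b' T - a' T = D' at *
      rw [← mul_div_assoc, div_le_iff₀ hT] at hl hl'
      rw [← mul_div_assoc, le_div_iff₀ hT] at hu hu'
      have hq : 0 < q * T := lt_of_lt_of_le (mul_pos hD (by linarith)) hl
      have e1 : q' / q = (q' * T) / (q * T) := (mul_div_mul_right _ _ hT.ne').symm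
      rw [e1]
      generalize q * T = r at *
      generalize q' * T = r' at *
      have hr : D / 2 ≤ r := by nlinarith
      rw [div_sub_div _ _ hq.ne' hD.ne', abs_div, abs_of_pos (mul_pos hq hD),
        div_lt_iff₀ (mul_pos hq hD)]
      have hb1 : |r' * D - r * D'| ≤ 2 * δ * (D' * D) := by
        rw [abs_le]
        constructor <;> nlinarith
      calc _ ≤ 2 * δ * (D' * D) := hb1
        _ ≤ 2 * δ * (D * D) := by gcongr
        _ ≤ 2 * δ * (2 * r * D) := by gcongr; linarith
        _ = 4 * δ * (r * D) := by ring
        _ < η * (r * D) := by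
          refine mul_lt_mul_of_pos_right (by linarith) (mul_pos hq hD)
    simpa using hdiff.add hθ
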